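/- Let $\alpha>0$, $k>0$, and let $H=L^2(0,1)$ be the real Hilbert space with the weighted inner product $\langle f,g\rangle=\int_0^1 e^{-\alpha\xi}f(\xi)g(\xi)\,d\xi$. Let $A=A_0+kI$, where $A_0h=h''-\alpha h'$ with domain $$D(A_0)=\{h\in H:\ h,\,h'\text{ absolutely continuous on }[0,1],\ h''\in H,\ h(0)=h(1)=0\},$$ let $b\in H$, and let $B:\mathbb R\to H$, $Bu=ub$. Consider the system $\dot x(t)=Ax(t)+Bu(t)$, $x(0)=x_0$. A $C_0$-semigroup $T(t)$ is called asymptotically stable if $T(t)x\to0$ as $t\to\infty$ for every $x$, and exponentially stable if there are $M,\omega>0$ with $\|T(t)x\|\le Me^{-\omega t}\|x\|$ for all $t\ge0$ and all $x$. An operator is called asymptotically (resp. exponentially) stable if it is the infinitesimal generator of an asymptotically (resp. exponentially) stable $C_0$-semigroup. The pair $(A,b)$ is called stabilizable (resp. exponentially stabilizable) if there is a bounded linear functional $F:H\to\mathbb R$ such that $A+BF$, with domain $D(A_0)$, is asymptotically (resp. exponentially) stable. **Proposition 3.1.** The operator $A$ is the infinitesimal generator of a $C_0$-semigroup $S(t)$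 on $H$. Let $N=\bigcap_{t\ge0}\ker B^*S(t)^*$ be the uncontrollable subspace, and let $A_{22}$ be the restriction of $A$ to $N$, that is, the operator on $N$ with domain $\{x\in N\cap D(A_0): Ax\in N\}$ and $A_{22}x=Ax$. Then: 1. $(A,b)$ is stabilizable if and only if $A_{22}$ is asymptotically stable; 2. $(A,b)$ is exponentially stabilizable if and only if $A_{22}$ is exponentially stable. -/

import Mathlib

open MeasureTheory Set Filter Topology
open scoped NNReal ENNReal

noncomputable section

namespace DiffusionStab

/-! ### Strongly continuous semigroups, stability, stabilizability -/

section Abstract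

variable {X : Type*} [NormedAddCommGroup X] [NormedSpace ℝ X]

/-- A strongly continuous (C₀-) semigroup of bounded linear operators on `X`. -/
structure C0Semigroup (X : Type*) [NormedAddCommGroup X] [NormedSpace ℝ X] where
  /-- the operators `S(t)`, `t ≥ 0` -/
  op : ℝ≥0 → X →L[ℝ] X
  op_zero : op 0 = ContinuousLinearMap.id ℝ X
  op_add : ∀ s t, op (s + t) = (op s).comp (op t)
  strongly_continuous : ∀ x, Continuous fun t => op t x

/-- The (unbounded) operator `A` is the infinitesimal generator of the semigroup `S`: the domain
of `A` consists of those `x` for which the right derivative of `t ↦ S(t)x` at `0` exists, and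
`A x` is this derivative. -/
def IsGenerator (A : X →ₗ.[ℝ] X) (S : C0Semigroup X) : Prop :=
  ∀ x y : X, (x, y) ∈ A.graph ↔
    Tendsto (fun t : ℝ≥0 => (t : ℝ)⁻¹ • (S.op t x - x)) (𝓝[>] 0) (𝓝 y)

/-- Asymptotic stability of a semigroup: every orbit tends to zero. -/
def C0Semigroup.IsAsymptoticallyStable (S : C0Semigroup X) : Prop :=
  ∀ x, Tendsto (fun t => S.op t x) atTop (𝓝 0)

/-- Exponential stability of a semigroup: `‖S(t)x‖ ≤ M e^{-ωt} ‖x‖` with `M, ω > 0`. -/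
def C0Semigroup.IsExponentiallyStable (S : C0Semigroup X) : Prop :=
  ∃ M > 0, ∃ ω > 0, ∀ (t : ℝ≥0) (x : X), ‖S.op t x‖ ≤ M * Real.exp (-(ω * (t : ℝ))) * ‖x‖

/-- `A` generates an asymptotically stable C₀-semigroup. (A C₀-semigroup is determined by
its generator, so this says that *the* semigroup generated by `A` is asymptotically stable.) -/
def IsAsymptoticallyStable (A : X →ₗ.[ℝ] X) : Prop :=
  ∃ S : C0Semigroup X, IsGenerator A S ∧ S.IsAsymptoticallyStable

/-- `A` generates an exponentially stable C₀-semigroup. -/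
def IsExponentiallyStable (A : X →ₗ.[ℝ] X) : Prop :=
  ∃ S : C0Semigroup X, IsGenerator A S ∧ S.IsExponentiallyStable

variable {U : Type*} [NormedAddCommGroup U] [NormedSpace ℝ U]

/-- The closed loop operator `A + BF`, with domain that of `A`. -/
def closedLoop (A : X →ₗ.[ℝ] X) (B : U →L[ℝ] X) (F : X →L[ℝ] U) : X →ₗ.[ℝ] X :=
  ((B.comp F : X →L[ℝ] X) : X →ₗ[ℝ] X) +ᵥ A

/-- `(A, B)` is stabilizable: some bounded feedback makes `A + BF` asymptotically stable. -/
def IsStabilizable (A : X →ₗ.[ℝ] X) (B : U →L[ℝ] X) : Prop :=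
  ∃ F : X →L[ℝ] U, IsAsymptoticallyStable (closedLoop A B F)

/-- `(A, B)` is exponentially stabilizable: some bounded feedback makes `A + BF`
exponentially stable. -/
def IsExponentiallyStabilizable (A : X →ₗ.[ℝ] X) (B : U →L[ℝ] X) : Prop :=
  ∃ F : X →L[ℝ] U, IsExponentiallyStable (closedLoop A B F)

/-- The restriction (part) of an unbounded operator `A` in a subspace `N`: its domain is
`{x ∈ N ∩ D(A) : A x ∈ N}` and there it acts as `A`. -/
def restrictTo (A : X →ₗ.[ℝ] X) (N : Submodule ℝ X) : N →ₗ.[ℝ] N where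
  domain :=
    { carrier := {x | ∃ hx : (x : X) ∈ A.domain, A ⟨x, hx⟩ ∈ N}
      zero_mem' := ⟨A.domain.zero_mem, by
        have h : (⟨((0 : N) : X), A.domain.zero_mem⟩ : A.domain) = 0 := rfl
        rw [h, A.map_zero]
        exact N.zero_mem⟩
      add_mem' := by
        rintro x y ⟨hx, hx'⟩ ⟨hy, hy'⟩
        refine ⟨A.domain.add_mem hx hy, ?_⟩
        have h := A.map_add ⟨x, hx⟩ ⟨y, hy⟩
        exact h ▸ N.add_mem hx' hy'
      smul_mem' := by
        rintro c x ⟨hx, hx'⟩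
        refine ⟨A.domain.smul_mem c hx, ?_⟩
        have h := A.map_smul c ⟨x, hx⟩
        exact h ▸ N.smul_mem c hx' }
  toFun :=
    { toFun := fun x => ⟨A ⟨((x : N) : X), x.2.1⟩, x.2.2⟩
      map_add' := fun x y => Subtype.ext
        (A.map_add ⟨((x : N) : X), x.2.1⟩ ⟨((y : N) : X), y.2.1⟩)
      map_smul' := fun c x => Subtype.ext (A.map_smul c ⟨((x : N) : X), x.2.1⟩) }

end Abstract

section Hilbert

variable {H : Type*} [NormedAddCommGroup H] [InnerProductSpace ℝ H] [CompleteSpace H]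
variable {U : Type*} [NormedAddCommGroup U] [InnerProductSpace ℝ U] [CompleteSpace U]

/-- The uncontrollable subspace `N = ⋂_{t ≥ 0} ker B* S*(t)`. -/
def uncontrollableSubspace (S : C0Semigroup H) (B : U →L[ℝ] H) : Submodule ℝ H :=
  ⨅ t : ℝ≥0, LinearMap.ker
    (((ContinuousLinearMap.adjoint B).comp (ContinuousLinearMap.adjoint (S.op t)) :
      H →L[ℝ] U) : H →ₗ[ℝ] U)

end Hilbert

/-! ### The diffusion operator -/

/-- The measure `exp(-α ξ) dξ` on `(0, 1)`. -/
def weightMeasure (α : ℝ) : Measure ℝ :=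
  (volume.restrict (Ioo (0 : ℝ) 1)).withDensity fun ξ => ENNReal.ofReal (Real.exp (-α * ξ))

/-- The state space: real `L²(0,1)` with inner product `⟨f, g⟩ = ∫₀¹ exp(-α ξ) f(ξ) g(ξ) dξ`. -/
abbrev StateSpace (α : ℝ) : Type := Lp ℝ 2 (weightMeasure α)

/-- First derivative of a function on `[0, 1]` (one-sided at the end points). -/
def d1 (f : ℝ → ℝ) : ℝ → ℝ := derivWithin f (Icc 0 1)

/-- Second derivative (almost everywhere on `(0, 1)`). -/
def d2 (f : ℝ → ℝ) : ℝ → ℝ := deriv (d1 f)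

/-- The conditions in the domain of the diffusion operator, on a pointwise defined function:
`f` and `f'` are absolutely continuous on `[0,1]`, `f'' ∈ L²` and `f(0) = f(1) = 0`. -/
structure InDomain (α : ℝ) (f : ℝ → ℝ) : Prop where
  ac : AbsolutelyContinuousOnInterval f 0 1
  diff : DifferentiableOn ℝ f (Icc 0 1)
  ac_d1 : AbsolutelyContinuousOnInterval (d1 f) 0 1
  memLp_d2 : MemLp (d2 f) 2 (weightMeasure α)
  left : f 0 = 0
  right : f 1 = 0

instance (α : ℝ) : IsFiniteMeasure (weightMeasure α) := by
  unfold weightMeasure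
  refine isFiniteMeasure_withDensity_ofReal ?_
  have h : IntegrableOn (fun ξ : ℝ => Real.exp (-α * ξ)) (Icc 0 1) volume :=
    ContinuousOn.integrableOn_Icc (by fun_prop)
  exact (h.mono_set Ioo_subset_Icc_self).2

theorem weightMeasure_ac (α : ℝ) : weightMeasure α ≪ volume.restrict (Ioo (0 : ℝ) 1) :=
  withDensity_absolutelyContinuous _ _

theorem ac_weightMeasure (α : ℝ) : volume.restrict (Ioo (0 : ℝ) 1) ≪ weightMeasure α :=
  withDensity_absolutelyContinuous' (by fun_prop)
    (Eventually.of_forall fun ξ => by simp [Real.exp_pos])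

theorem ae_mem_Ioo (α : ℝ) : ∀ᵐ ξ ∂weightMeasure α, ξ ∈ Ioo (0 : ℝ) 1 :=
  (weightMeasure_ac α).ae_le (ae_restrict_mem measurableSet_Ioo)

theorem d1_add {f g : ℝ → ℝ} (hf : DifferentiableOn ℝ f (Icc 0 1))
    (hg : DifferentiableOn ℝ g (Icc 0 1)) : EqOn (d1 (f + g)) (d1 f + d1 g) (Icc 0 1) :=
  fun x hx => derivWithin_add (hf x hx) (hg x hx)

theorem d1_smul (c : ℝ) (f : ℝ → ℝ) : d1 (c • f) = c • d1 f := by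
  funext x
  simp [d1, derivWithin_const_smul_field]

theorem d2_smul (c : ℝ) (f : ℝ → ℝ) : d2 (c • f) = c • d2 f := by
  funext x
  simp [d2, d1_smul, deriv_const_smul_field]

theorem ac_congr {f g : ℝ → ℝ} (hf : AbsolutelyContinuousOnInterval f 0 1)
    (h : EqOn f g (Icc 0 1)) : AbsolutelyContinuousOnInterval g 0 1 := by
  rw [absolutelyContinuousOnInterval_iff] at hf ⊢
  intro ε hε
  obtain ⟨δ, hδ, H⟩ := hf ε hε
  refine ⟨δ, hδ, fun E hE hE' => ?_⟩
  have H' := H E hE hE'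
  have hE2 := hE.1
  rw [uIcc_of_le zero_le_one] at hE2
  rwa [Finset.sum_congr rfl fun i hi => by rw [← h (hE2 i hi).1, ← h (hE2 i hi).2]]

theorem deriv_eqOn_Ioo {f g : ℝ → ℝ} (h : EqOn f g (Icc 0 1)) :
    EqOn (deriv f) (deriv g) (Ioo 0 1) := fun _ hx =>
  Filter.EventuallyEq.deriv_eq (Filter.eventuallyEq_of_mem (Icc_mem_nhds hx.1 hx.2) h)

theorem d2_add_ae {α : ℝ} {f g : ℝ → ℝ} (hf : InDomain α f) (hg : InDomain α g) :
    d2 (f + g) =ᵐ[weightMeasure α] d2 f + d2 g := by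
  have h1 := (weightMeasure_ac α).ae_le (ae_restrict_of_ae hf.ac_d1.ae_differentiableAt)
  have h2 := (weightMeasure_ac α).ae_le (ae_restrict_of_ae hg.ac_d1.ae_differentiableAt)
  filter_upwards [h1, h2, ae_mem_Ioo α] with x hx1 hx2 hx
  have hx' : x ∈ uIcc (0 : ℝ) 1 := by
    rw [uIcc_of_le zero_le_one]; exact Ioo_subset_Icc_self hx
  have e := deriv_eqOn_Ioo (d1_add hf.diff hg.diff) hx
  rw [d2, e, deriv_add (hx1 hx') (hx2 hx')]
  rfl

theorem InDomain.add {α : ℝ} {f g : ℝ → ℝ} (hf : InDomain α f) (hg : InDomain α g) :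
    InDomain α (f + g) where
  ac := hf.ac.add hg.ac
  diff := hf.diff.add hg.diff
  ac_d1 := ac_congr (hf.ac_d1.add hg.ac_d1) (d1_add hf.diff hg.diff).symm
  memLp_d2 := (hf.memLp_d2.add hg.memLp_d2).ae_eq (d2_add_ae hf hg).symm
  left := by simp [hf.left, hg.left]
  right := by simp [hf.right, hg.right]

theorem InDomain.smul {α : ℝ} (c : ℝ) {f : ℝ → ℝ} (hf : InDomain α f) :
    InDomain α (c • f) where
  ac := hf.ac.const_smul c
  diff := hf.diff.const_smul c
  ac_d1 := by rw [d1_smul]; exact hf.ac_d1.const_smul c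
  memLp_d2 := by rw [d2_smul]; exact hf.memLp_d2.const_smul c
  left := by simp [hf.left]
  right := by simp [hf.right]

theorem inDomain_zero (α : ℝ) : InDomain α 0 := by
  have h1 : d1 (0 : ℝ → ℝ) = (0 : ℝ → ℝ) := by funext x; simp [d1]
  have h2 : d2 (0 : ℝ → ℝ) = (0 : ℝ → ℝ) := by
    funext x
    rw [d2, h1]
    exact deriv_const x 0
  have h0 : AbsolutelyContinuousOnInterval (0 : ℝ → ℝ) 0 1 :=
    (contDiff_const (c := (0 : ℝ))).contDiffOn.absolutelyContinuousOnInterval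
  exact ⟨h0, differentiableOn_const 0, by rwa [h1], by rw [h2]; exact MemLp.zero, rfl, rfl⟩

/-- The differential expression `f'' - α f'`. -/
def diffusionExpr (α : ℝ) (f : ℝ → ℝ) : ℝ → ℝ := d2 f - α • d1 f

theorem InDomain.memLp_d1 {α : ℝ} {f : ℝ → ℝ} (hf : InDomain α f) :
    MemLp (d1 f) 2 (weightMeasure α) := by
  have hc : ContinuousOn (d1 f) (Icc 0 1) := by
    have := hf.ac_d1.continuousOn
    rwa [uIcc_of_le zero_le_one] at this
  obtain ⟨C, hC⟩ := isCompact_Icc.exists_bound_of_continuousOn hc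
  refine MemLp.of_bound ?_ C ?_
  · exact ((hc.mono Ioo_subset_Icc_self).aestronglyMeasurable measurableSet_Ioo).mono_ac
      (weightMeasure_ac α)
  · filter_upwards [ae_mem_Ioo α] with x hx using hC x (Ioo_subset_Icc_self hx)

theorem InDomain.memLp_expr {α : ℝ} {f : ℝ → ℝ} (hf : InDomain α f) :
    MemLp (diffusionExpr α f) 2 (weightMeasure α) :=
  hf.memLp_d2.sub (hf.memLp_d1.const_smul α)

theorem diffusionExpr_add {α : ℝ} {f g : ℝ → ℝ} (hf : InDomain α f) (hg : InDomain α g) :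
    diffusionExpr α (f + g) =ᵐ[weightMeasure α] diffusionExpr α f + diffusionExpr α g := by
  filter_upwards [d2_add_ae hf hg, ae_mem_Ioo α] with x hx hx'
  have e := d1_add hf.diff hg.diff (Ioo_subset_Icc_self hx')
  simp only [diffusionExpr, Pi.sub_apply, Pi.smul_apply, Pi.add_apply, smul_eq_mul] at *
  rw [hx, e]; ring

theorem diffusionExpr_smul (α c : ℝ) (f : ℝ → ℝ) :
    diffusionExpr α (c • f) = c • diffusionExpr α f := by
  simp only [diffusionExpr, d1_smul, d2_smul, smul_sub, smul_comm α c]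

/-- The differential expression depends only on the almost everywhere class of `f`. -/
theorem diffusionExpr_congr {α : ℝ} {f g : ℝ → ℝ} (hf : InDomain α f) (hg : InDomain α g)
    (h : f =ᵐ[weightMeasure α] g) :
    diffusionExpr α f =ᵐ[weightMeasure α] diffusionExpr α g := by
  have hI : EqOn f g (Ioo 0 1) :=
    Measure.eqOn_open_of_ae_eq ((ac_weightMeasure α).ae_le h) isOpen_Ioo
      (hf.diff.continuousOn.mono Ioo_subset_Icc_self)
      (hg.diff.continuousOn.mono Ioo_subset_Icc_self)
  have hI' : EqOn f g (Icc 0 1) := by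
    intro x hx
    rcases eq_or_lt_of_le hx.1 with h0 | h0
    · rw [← h0, hf.left, hg.left]
    rcases eq_or_lt_of_le hx.2 with h1 | h1
    · rw [h1, hf.right, hg.right]
    exact hI ⟨h0, h1⟩
  have e1 : EqOn (d1 f) (d1 g) (Icc 0 1) := fun x hx => derivWithin_congr hI' (hI' hx)
  have e2 : EqOn (d2 f) (d2 g) (Ioo 0 1) := deriv_eqOn_Ioo e1
  filter_upwards [ae_mem_Ioo α] with x hx
  simp only [diffusionExpr, Pi.sub_apply, Pi.smul_apply]
  rw [e1 (Ioo_subset_Icc_self hx), e2 hx]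

/-- The domain `D(A₀)`: classes in `L²(0,1)` having a representative `f` such that `f, f'` are
absolutely continuous, `f'' ∈ L²`, and `f(0) = f(1) = 0`. -/
def diffusionDomain (α : ℝ) : Submodule ℝ (StateSpace α) where
  carrier := {h | ∃ f : ℝ → ℝ, InDomain α f ∧ h =ᵐ[weightMeasure α] f}
  zero_mem' := ⟨0, inDomain_zero α, Lp.coeFn_zero _ _ _⟩
  add_mem' := by
    rintro h₁ h₂ ⟨f₁, hf₁, e₁⟩ ⟨f₂, hf₂, e₂⟩
    exact ⟨f₁ + f₂, hf₁.add hf₂, (Lp.coeFn_add h₁ h₂).trans (e₁.add e₂)⟩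
  smul_mem' := by
    rintro c h ⟨f, hf, e⟩
    exact ⟨c • f, hf.smul c, (Lp.coeFn_smul c h).trans (e.const_smul c)⟩

/-- The operator `A₀ h = h'' - α h'` with domain `D(A₀)`; the value does not depend on the
representative chosen. -/
def diffusionA₀ (α : ℝ) : StateSpace α →ₗ.[ℝ] StateSpace α where
  domain := diffusionDomain α
  toFun :=
    { toFun := fun h => h.2.choose_spec.1.memLp_expr.toLp (diffusionExpr α h.2.choose)
      map_add' := by
        intro h₁ h₂
        rw [← MemLp.toLp_add, MemLp.toLp_eq_toLp_iff]
        have s := (h₁ + h₂).2.choose_spec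
        have s₁ := h₁.2.choose_spec
        have s₂ := h₂.2.choose_spec
        refine (diffusionExpr_congr s.1 (s₁.1.add s₂.1) ?_).trans (diffusionExpr_add s₁.1 s₂.1)
        exact s.2.symm.trans ((Lp.coeFn_add _ _).trans (s₁.2.add s₂.2))
      map_smul' := by
        intro c h
        rw [RingHom.id_apply, ← MemLp.toLp_const_smul, MemLp.toLp_eq_toLp_iff]
        have s := (c • h).2.choose_spec
        have s₁ := h.2.choose_spec
        refine (diffusionExpr_congr s.1 (s₁.1.smul c) ?_).trans
          (Eventually.of_forall fun x => congrFun (diffusionExpr_smul α c _) x)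
        exact s.2.symm.trans ((Lp.coeFn_smul _ _).trans (s₁.2.const_smul c)) }

/-- For every representative `f` as in the definition of the domain, `A₀ h = f'' - α f'`. -/
theorem diffusionA₀_apply {α : ℝ} (h : (diffusionA₀ α).domain) {f : ℝ → ℝ}
    (hf : InDomain α f) (e : (h : StateSpace α) =ᵐ[weightMeasure α] f) :
    diffusionA₀ α h =ᵐ[weightMeasure α] diffusionExpr α f := by
  have s := Exists.choose_spec (show ∃ f : ℝ → ℝ, InDomain α f ∧
    (h : StateSpace α) =ᵐ[weightMeasure α] f from h.2)
  exact (MemLp.coeFn_toLp s.1.memLp_expr).trans (diffusionExpr_congr s.1 hf (s.2.symm.trans e))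

/-- The system operator `A = A₀ + k I`, with domain `D(A₀)`. -/
def diffusionA (α k : ℝ) : StateSpace α →ₗ.[ℝ] StateSpace α :=
  (k • (LinearMap.id : StateSpace α →ₗ[ℝ] StateSpace α)) +ᵥ diffusionA₀ α

/-- The input operator `B u = u b` on the input space `ℝ`. -/
def inputOp {α : ℝ} (b : StateSpace α) : ℝ →L[ℝ] StateSpace α :=
  ContinuousLinearMap.toSpanSingleton ℝ b

end DiffusionStab

end

/-!
The operator `A` is diagonalized by the functions `√2 exp(α ξ / 2) sin((n + 1) π ξ)`, which form a
Hilbert basis `e` of the weighted space; the eigenvalues `ν n = k - α² / 4 - (n + 1)² π²` are simple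
and tend to `-∞`. Completeness of the basis comes from Parseval's identity for odd extensions, and
`A` is the maximal diagonal operator because the boundary value problem `f'' - α f' = g` has an
explicit solution (`mem_graph_diffusionA_iff_isDiagPair`). The rest of the argument holds for every
diagonal operator with simple eigenvalues tending to `-∞` (`stabilizable_iff_of_diagonal`).

Such an operator generates the semigroup of multiplication by `exp (ν n t)`, and this is the only
semigroup it generates (`isDiagSemigroup_of_generatorRel`). By uniqueness for Dirichlet series, the
uncontrollable subspace consists of the vectors whose coordinates vanish wherever those of `b` do
not. All four properties in the statement then turn out to be equivalent to the condition

  `⟪e n, b⟫ = 0` implies `ν n < 0`, for every `n`.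

* If `⟪e n, b⟫ = 0`, then `⟪e n, ·⟫` is an eigenfunctional, with eigenvalue `ν n`, of every
  closed-loop operator `A + B F` and of the restriction `A₂₂`. The semigroup multiplies it by
  `exp (ν n t)`, so that asymptotic stability forces `ν n < 0`
  (`C0Semigroup.IsAsymptoticallyStable.eigenvalue_neg`).
* Conversely, under the condition the eigenvalues of `A₂₂` are negative and bounded away from `0`, which
  makes `A₂₂` exponentially stable. For the full system, only finitely many modes are unstable and all
  of them are controllable; they are moved to the left half-line one at a time by
  rank-one feedbacks (`exists_feedback_of_diagonal`).
-/

noncomputable section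

namespace DiffusionStab

/-! ### Semigroups and their generators -/

section Semigroups

variable {X : Type*} [NormedAddCommGroup X] [NormedSpace ℝ X]
variable {Y : Type*} [NormedAddCommGroup Y] [NormedSpace ℝ Y]

/-- The graph of the infinitesimal generator of `S`, as a relation: `x` lies in the domain of the
generator and is mapped to `y`. -/
def C0Semigroup.GeneratorRel (S : C0Semigroup X) (x y : X) : Prop :=
  Tendsto (fun t : ℝ≥0 => (t : ℝ)⁻¹ • (S.op t x - x)) (𝓝[>] 0) (𝓝 y)

theorem C0Semigroup.GeneratorRel.op {S : C0Semigroup X} {x y : X} (h : S.GeneratorRel x y)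
    (t : ℝ≥0) : S.GeneratorRel (S.op t x) (S.op t y) := by
  refine (((S.op t).continuous.tendsto y).comp h).congr fun s => ?_
  have e : S.op s (S.op t x) = S.op t (S.op s x) := by
    have h1 := DFunLike.congr_fun (S.op_add s t) x
    have h2 := DFunLike.congr_fun (S.op_add t s) x
    rw [add_comm s t] at h1
    exact h1.symm.trans h2
  simp [e]

theorem tendsto_toNNReal_sub_nhdsGT (s : ℝ) :
    Tendsto (fun r : ℝ => (r - s).toNNReal) (𝓝[>] s) (𝓝[>] 0) := by
  refine tendsto_nhdsWithin_iff.2 ⟨?_, ?_⟩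
  · have : Continuous fun r : ℝ => (r - s).toNNReal := by fun_prop
    have h := (this.tendsto s).mono_left (nhdsWithin_le_nhds (s := Ioi s))
    simpa using h
  · filter_upwards [self_mem_nhdsWithin] with r hr
    simpa using hr

theorem C0Semigroup.GeneratorRel.hasDerivWithinAt {S : C0Semigroup X} {x y : X}
    (h : S.GeneratorRel x y) {s : ℝ} (hs : 0 ≤ s) :
    HasDerivWithinAt (fun r : ℝ => S.op r.toNNReal x) (S.op s.toNNReal y) (Ici s) s := by
  rw [← hasDerivWithinAt_Ioi_iff_Ici, hasDerivWithinAt_iff_tendsto_slope' (by simp)]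
  refine ((h.op s.toNNReal).comp (tendsto_toNNReal_sub_nhdsGT s)).congr' ?_
  filter_upwards [self_mem_nhdsWithin] with r hr
  have hr' : 0 ≤ r - s := sub_nonneg.2 (le_of_lt hr)
  have e : r.toNNReal = (r - s).toNNReal + s.toNNReal := by
    rw [← Real.toNNReal_add hr' hs]; congr 1; ring
  simp only [Function.comp_apply, slope_def_module]
  rw [e, S.op_add, Real.coe_toNNReal _ hr']
  rfl

/-- A functional that is an eigenvector of the dual of the generator is an eigenvector of the dual
semigroup. -/
theorem C0Semigroup.apply_op_of_eigenfunctional (S : C0Semigroup X) (φ : X →L[ℝ] ℝ) {μ : ℝ}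
    (hφ : ∀ x y, S.GeneratorRel x y → φ y = μ * φ x) {x y : X} (h : S.GeneratorRel x y)
    (t : ℝ≥0) : φ (S.op t x) = Real.exp (μ * t) * φ x := by
  set g : ℝ → ℝ := fun r => Real.exp (-μ * r) * φ (S.op r.toNNReal x) with hg
  have hcont : Continuous g := by
    have h1 : Continuous fun r : ℝ => S.op r.toNNReal x :=
      (S.strongly_continuous x).comp continuous_real_toNNReal
    fun_prop
  have hder : ∀ s ∈ Ico (0 : ℝ) t, HasDerivWithinAt g 0 (Ici s) s := by
    intro s hs
    have h1 := φ.hasFDerivAt.comp_hasDerivWithinAt s (h.hasDerivWithinAt hs.1)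
    have h2 : HasDerivWithinAt (fun r : ℝ => Real.exp (-μ * r)) (Real.exp (-μ * s) * (-μ * 1))
        (Ici s) s := (((hasDerivAt_id s).const_mul (-μ)).exp).hasDerivWithinAt
    refine (h2.mul h1).congr_deriv ?_
    rw [hφ _ _ (h.op s.toNNReal)]
    simp only [Function.comp_apply]
    ring
  have key := constant_of_has_deriv_right_zero hcont.continuousOn hder t ⟨t.2, le_rfl⟩
  have h0 : g 0 = φ x := by simp [hg, S.op_zero]
  have ht : g t = Real.exp (-μ * t) * φ (S.op t x) := by simp [hg]
  rw [h0, ht] at key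
  rw [← key, ← mul_assoc, ← Real.exp_add]
  simp

/-- The semigroup `P S(t) P⁻¹`. -/
def C0Semigroup.conj (S : C0Semigroup X) (P : X ≃L[ℝ] Y) : C0Semigroup Y where
  op t := (P : X →L[ℝ] Y).comp ((S.op t).comp (P.symm : Y →L[ℝ] X))
  op_zero := by ext x; simp [S.op_zero]
  op_add s t := by ext x; simp [S.op_add]
  strongly_continuous x := P.continuous.comp (S.strongly_continuous (P.symm x))

theorem C0Semigroup.conj_op (S : C0Semigroup X) (P : X ≃L[ℝ] Y) (t : ℝ≥0) (y : Y) :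
    (S.conj P).op t y = P (S.op t (P.symm y)) := rfl

theorem C0Semigroup.generatorRel_conj (S : C0Semigroup X) (P : X ≃L[ℝ] Y) (x y : Y) :
    (S.conj P).GeneratorRel x y ↔ S.GeneratorRel (P.symm x) (P.symm y) := by
  unfold GeneratorRel
  rw [P.symm.toHomeomorph.isInducing.tendsto_nhds_iff]
  refine tendsto_congr fun t => ?_
  simp [conj_op]

theorem C0Semigroup.IsExponentiallyStable.conj {S : C0Semigroup X}
    (hS : S.IsExponentiallyStable) (P : X ≃L[ℝ] Y) : (S.conj P).IsExponentiallyStable := by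
  obtain ⟨M, hM, ω, hω, h⟩ := hS
  refine ⟨(‖(P : X →L[ℝ] Y)‖ + 1) * M * (‖(P.symm : Y →L[ℝ] X)‖ + 1), by positivity, ω, hω,
    fun t x => ?_⟩
  rw [conj_op]
  have h1 : ‖P (S.op t (P.symm x))‖ ≤ (‖(P : X →L[ℝ] Y)‖ + 1) * ‖S.op t (P.symm x)‖ :=
    ((P : X →L[ℝ] Y).le_opNorm _).trans (by gcongr; linarith)
  have h2 : ‖P.symm x‖ ≤ (‖(P.symm : Y →L[ℝ] X)‖ + 1) * ‖x‖ :=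
    ((P.symm : Y →L[ℝ] X).le_opNorm _).trans (by gcongr; linarith)
  calc ‖P (S.op t (P.symm x))‖
      ≤ (‖(P : X →L[ℝ] Y)‖ + 1) * (M * Real.exp (-(ω * (t : ℝ))) *
          ((‖(P.symm : Y →L[ℝ] X)‖ + 1) * ‖x‖)) := by
        refine h1.trans ?_
        gcongr
        exact (h t _).trans (by gcongr)
    _ = _ := by ring

/-- The restriction of a semigroup to an invariant subspace. -/
def C0Semigroup.restrict (S : C0Semigroup X) (N : Submodule ℝ X)
    (hN : ∀ t, ∀ x ∈ N, S.op t x ∈ N) : C0Semigroup N where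
  op t := ((S.op t).comp N.subtypeL).codRestrict N fun x => hN t x x.2
  op_zero := by ext x; simp [S.op_zero]
  op_add s t := by ext x; simp [S.op_add]; rfl
  strongly_continuous x := (S.strongly_continuous (x : X)).subtype_mk _

theorem mem_graph_restrictTo (A : X →ₗ.[ℝ] X) (N : Submodule ℝ X) (x y : N) :
    (x, y) ∈ (restrictTo A N).graph ↔ ((x : X), (y : X)) ∈ A.graph := by
  simp only [LinearPMap.mem_graph_iff]
  constructor
  · rintro ⟨z, h1, h2⟩
    exact ⟨⟨((z : N) : X), z.2.1⟩, congrArg Subtype.val h1, congrArg Subtype.val h2⟩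
  · rintro ⟨⟨z, hz⟩, h1, h2⟩
    dsimp only at h1 h2
    subst h1
    exact ⟨⟨x, hz, h2 ▸ y.2⟩, rfl, Subtype.ext h2⟩

theorem IsGenerator.restrictTo {A : X →ₗ.[ℝ] X} {S : C0Semigroup X} (hS : IsGenerator A S)
    (N : Submodule ℝ X) (hN : ∀ t, ∀ x ∈ N, S.op t x ∈ N) :
    IsGenerator (restrictTo A N) (S.restrict N hN) := by
  intro x y
  rw [mem_graph_restrictTo, hS, tendsto_subtype_rng]
  rfl

theorem mem_graph_closedLoop {U : Type*} [NormedAddCommGroup U] [NormedSpace ℝ U]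
    (A : X →ₗ.[ℝ] X) (B : U →L[ℝ] X) (F : X →L[ℝ] U) (x y : X) :
    (x, y) ∈ (closedLoop A B F).graph ↔ (x, y - B (F x)) ∈ A.graph := by
  simp only [LinearPMap.mem_graph_iff]
  constructor
  · rintro ⟨z, h1, h2⟩
    refine ⟨z, h1, ?_⟩
    rw [← h2, ← h1]
    exact (add_sub_cancel_left (B (F z)) _).symm
  · rintro ⟨z, h1, h2⟩
    refine ⟨z, h1, ?_⟩
    subst h1
    exact (congrArg (B (F z) + ·) h2).trans (add_sub_cancel _ _)

theorem C0Semigroup.IsExponentiallyStable.isAsymptoticallyStable {S : C0Semigroup X}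
    (hS : S.IsExponentiallyStable) : S.IsAsymptoticallyStable := by
  obtain ⟨M, hM, ω, hω, h⟩ := hS
  intro x
  refine squeeze_zero_norm (h · x) ?_
  have h1 : Tendsto (fun t : ℝ≥0 => ω * (t : ℝ)) atTop atTop :=
    NNReal.tendsto_coe_atTop.2 tendsto_id |>.const_mul_atTop hω
  have h2 := ((Real.tendsto_exp_neg_atTop_nhds_zero.comp h1).const_mul M).mul_const ‖x‖
  simpa using h2

theorem IsExponentiallyStable.isAsymptoticallyStable {A : X →ₗ.[ℝ] X}
    (hA : IsExponentiallyStable A) : IsAsymptoticallyStable A :=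
  let ⟨S, hS, h⟩ := hA
  ⟨S, hS, h.isAsymptoticallyStable⟩

/-- An eigenvalue of the dual of the generator of an asymptotically stable semigroup is negative if
it has an eigenfunctional that does not vanish on the domain of the generator. -/
theorem C0Semigroup.IsAsymptoticallyStable.eigenvalue_neg {S : C0Semigroup X}
    (hS : S.IsAsymptoticallyStable) (φ : X →L[ℝ] ℝ) {μ : ℝ}
    (hφ : ∀ x y, S.GeneratorRel x y → φ y = μ * φ x) {x y : X} (h : S.GeneratorRel x y)
    (hx : φ x ≠ 0) : μ < 0 := by
  by_contra! hμ
  have h1 : Tendsto (fun t : ℝ≥0 => |φ (S.op t x)|) atTop (𝓝 0) := by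
    have := ((φ.continuous.tendsto 0).comp (hS x)).abs
    simpa using this
  have h2 : |φ x| ≤ 0 := by
    refine ge_of_tendsto' h1 fun t => ?_
    rw [S.apply_op_of_eigenfunctional φ hφ h t, abs_mul, Real.abs_exp]
    exact le_mul_of_one_le_left (abs_nonneg _) (Real.one_le_exp (by positivity))
  exact hx (abs_nonpos_iff.1 h2)

end Semigroups

/-! ### Diagonal operators and the semigroups they generate -/

section Diagonal

variable {ι : Type*} {H : Type*} [NormedAddCommGroup H] [InnerProductSpace ℝ H]

theorem hasSum_sq_inner (e : HilbertBasis ι ℝ H) (x : H) :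
    HasSum (fun i => inner ℝ (e i) x ^ 2) (‖x‖ ^ 2) := by
  have h := e.hasSum_inner_mul_inner x x
  rw [real_inner_self_eq_norm_sq] at h
  simpa only [sq, real_inner_comm x] using h

theorem ext_inner_basis (e : HilbertBasis ι ℝ H) {x y : H}
    (h : ∀ i, inner ℝ (e i) x = inner ℝ (e i) y) : x = y :=
  e.repr.injective (lp.ext (funext fun i => by
    rw [e.repr_apply_apply, e.repr_apply_apply, h]))

theorem norm_le_of_abs_inner_le (e : HilbertBasis ι ℝ H) {x y : H} {C : ℝ} (hC : 0 ≤ C)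
    (h : ∀ i, |inner ℝ (e i) y| ≤ C * |inner ℝ (e i) x|) : ‖y‖ ≤ C * ‖x‖ := by
  refine le_of_sq_le_sq ?_ (by positivity)
  rw [mul_pow]
  refine hasSum_le (fun i => ?_) (hasSum_sq_inner e y) ((hasSum_sq_inner e x).mul_left (C ^ 2))
  have := pow_le_pow_left₀ (abs_nonneg _) (h i) 2
  rwa [mul_pow, sq_abs, sq_abs] at this

/-- Dominated convergence in coordinates. -/
theorem tendsto_zero_of_inner (e : HilbertBasis ι ℝ H) {T : Type*} {l : Filter T} {f : T → H}
    {g : H} {C : ℝ} (hb : ∀ᶠ t in l, ∀ i, |inner ℝ (e i) (f t)| ≤ C * |inner ℝ (e i) g|)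
    (h : ∀ i, Tendsto (fun t => inner ℝ (e i) (f t)) l (𝓝 0)) : Tendsto f l (𝓝 0) := by
  have h1 : Tendsto (fun t => ∑' i, inner ℝ (e i) (f t) ^ 2) l (𝓝 (∑' _ : ι, (0 : ℝ))) := by
    refine tendsto_tsum_of_dominated_convergence
      (((hasSum_sq_inner e g).summable.mul_left (C ^ 2))) (fun i => ?_) ?_
    · simpa using (h i).pow 2
    · filter_upwards [hb] with t ht i
      have := pow_le_pow_left₀ (abs_nonneg _) (ht i) 2
      rw [Real.norm_eq_abs, abs_of_nonneg (sq_nonneg _)]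
      rwa [mul_pow, sq_abs, sq_abs] at this
  rw [tsum_zero] at h1
  have h2 : Tendsto (fun t => ‖f t‖ ^ 2) l (𝓝 0) :=
    h1.congr fun t => (hasSum_sq_inner e (f t)).tsum_eq
  have h3 := h2.sqrt
  simp only [Real.sqrt_sq (norm_nonneg _), Real.sqrt_zero] at h3
  exact tendsto_zero_iff_norm_tendsto_zero.2 h3

theorem exists_inner_eq_mul (e : HilbertBasis ι ℝ H) {m : ι → ℝ} {C : ℝ} (hm : ∀ i, |m i| ≤ C)
    (x : H) : ∃ y, ∀ i, inner ℝ (e i) y = m i * inner ℝ (e i) x := by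
  have hmem : Memℓp (fun i => m i * inner ℝ (e i) x) 2 := by
    refine memℓp_gen ?_
    have hs := (hasSum_sq_inner e x).summable.mul_left (C ^ 2)
    refine Summable.of_nonneg_of_le (fun i => by positivity) (fun i => ?_) hs
    simp only [ENNReal.toReal_ofNat, Real.rpow_two, Real.norm_eq_abs, sq_abs, mul_pow]
    refine mul_le_mul_of_nonneg_right ?_ (sq_nonneg _)
    exact sq_le_sq' (abs_le.1 (hm i)).1 (abs_le.1 (hm i)).2
  refine ⟨e.repr.symm ⟨_, hmem⟩, fun i => ?_⟩
  rw [← e.repr_apply_apply, LinearIsometryEquiv.apply_symm_apply]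

/-- The bounded diagonal operator with multipliers `m`. -/
theorem exists_diagonalMap (e : HilbertBasis ι ℝ H) {m : ι → ℝ} {C : ℝ} (hm : ∀ i, |m i| ≤ C) :
    ∃ M : H →L[ℝ] H, ∀ x i, inner ℝ (e i) (M x) = m i * inner ℝ (e i) x := by
  choose M hM using exists_inner_eq_mul e hm
  refine ⟨LinearMap.mkContinuous
    { toFun := M
      map_add' := fun x y => ext_inner_basis e fun i => by
        rw [inner_add_right, hM, hM, hM, inner_add_right, mul_add]
      map_smul' := fun c x => ext_inner_basis e fun i => by
        simp only [RingHom.id_apply, inner_smul_right, hM]; ring } (max C 0) fun x =>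
    norm_le_of_abs_inner_le e (le_max_right _ _) fun i => ?_, hM⟩
  change |inner ℝ (e i) (M x)| ≤ _
  rw [hM, abs_mul]
  gcongr
  exact (hm i).trans (le_max_left _ _)

/-- The graph, as a relation, of the maximal diagonal operator with eigenvectors `e i` and
eigenvalues `ν i`. No summability condition is needed in this form: `x` lies in the domain as soon
as the numbers `ν i * ⟪e i, x⟫` are the coordinates of some vector `y`. -/
def IsDiagPair (e : HilbertBasis ι ℝ H) (ν : ι → ℝ) (x y : H) : Prop :=
  ∀ i, inner ℝ (e i) y = ν i * inner ℝ (e i) x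

theorem inner_basis_eq_ite [DecidableEq ι] (e : HilbertBasis ι ℝ H) (i j : ι) :
    inner ℝ (e i) (e j) = if i = j then (1 : ℝ) else 0 :=
  orthonormal_iff_ite.1 e.orthonormal i j

theorem isDiagPair_basis (e : HilbertBasis ι ℝ H) (ν : ι → ℝ) (i : ι) :
    IsDiagPair e ν (e i) (ν i • e i) := by
  classical
  intro j
  rw [inner_smul_right, inner_basis_eq_ite]
  split_ifs with h
  · rw [h]
  · simp

/-- `S` is the semigroup `x ↦ ∑ exp (ν i t) ⟪e i, x⟫ e i`. -/
def IsDiagSemigroup (e : HilbertBasis ι ℝ H) (ν : ι → ℝ) (S : C0Semigroup H) : Prop :=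
  ∀ t x i, inner ℝ (e i) (S.op t x) = Real.exp (ν i * (t : ℝ≥0)) * inner ℝ (e i) x

theorem exists_isDiagSemigroup (e : HilbertBasis ι ℝ H) {ν : ι → ℝ} {ω : ℝ}
    (hν : ∀ i, ν i ≤ ω) : ∃ S : C0Semigroup H, IsDiagSemigroup e ν S := by
  have hexp : ∀ (t : ℝ≥0) i, |Real.exp (ν i * t)| ≤ Real.exp (ω * t) := fun t i => by
    rw [Real.abs_exp]
    exact Real.exp_le_exp.2 (mul_le_mul_of_nonneg_right (hν i) t.2)
  choose M hM using fun t : ℝ≥0 => exists_diagonalMap e (hexp t)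
  refine ⟨⟨M, ?_, fun s t => ?_, fun x => ?_⟩, hM⟩
  · ext x
    exact ext_inner_basis e fun i => by simp [hM]
  · ext x
    refine ext_inner_basis e fun i => ?_
    rw [ContinuousLinearMap.comp_apply, hM, hM, hM, NNReal.coe_add, mul_add, Real.exp_add,
      mul_assoc]
  · refine continuous_iff_continuousAt.2 fun s => ?_
    refine tendsto_sub_nhds_zero_iff.1 ?_
    refine tendsto_zero_of_inner e (g := x) (C := Real.exp (|ω| * (s + 1))) ?_ fun i => ?_
    · filter_upwards [Iic_mem_nhds (show s < s + 1 by simp)] with t ht i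
      have hle : ∀ r : ℝ≥0, r ≤ s + 1 → Real.exp (ν i * r) ≤ Real.exp (|ω| * (s + 1)) := by
        intro r hr
        have hr' : (r : ℝ) ≤ s + 1 := by exact_mod_cast hr
        refine Real.exp_le_exp.2 ?_
        exact (mul_le_mul_of_nonneg_right ((hν i).trans (le_abs_self ω)) r.2).trans
          (mul_le_mul_of_nonneg_left hr' (abs_nonneg ω))
      rw [inner_sub_right, hM, hM, ← sub_mul, abs_mul]
      gcongr
      rw [abs_le]
      constructor <;> linarith [hle t ht, hle s (by simp), Real.exp_pos (ν i * t),
        Real.exp_pos (ν i * s)]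
    · simp only [inner_sub_right, hM]
      have : Continuous fun t : ℝ≥0 => Real.exp (ν i * t) * inner ℝ (e i) x -
        Real.exp (ν i * s) * inner ℝ (e i) x := by fun_prop
      simpa using this.tendsto s

theorem abs_exp_sub_one_le_mul {a ω : ℝ} (ha : a ≤ ω) (hω : 0 ≤ ω) :
    |Real.exp a - 1| ≤ Real.exp ω * |a| := by
  have h1 : 1 ≤ Real.exp ω := Real.one_le_exp hω
  rcases le_total 0 a with h | h
  · have h2 := Real.add_one_le_exp (-a)
    have h3 : Real.exp a * Real.exp (-a) = 1 := by rw [← Real.exp_add]; simp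
    have h4 : Real.exp a ≤ Real.exp ω := Real.exp_le_exp.2 ha
    rw [abs_of_nonneg h, abs_of_nonneg (by linarith [Real.one_le_exp h])]
    nlinarith [Real.exp_pos a]
  · rw [abs_of_nonpos h, abs_of_nonpos (by linarith [Real.exp_le_one_iff.2 h])]
    nlinarith [Real.add_one_le_exp a]

theorem IsDiagSemigroup.generatorRel_iff {e : HilbertBasis ι ℝ H} {ν : ι → ℝ} {ω : ℝ}
    (hν : ∀ i, ν i ≤ ω) {S : C0Semigroup H} (hS : IsDiagSemigroup e ν S) (x y : H) :
    S.GeneratorRel x y ↔ IsDiagPair e ν x y := by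
  -- the difference quotient of `t ↦ exp (ν i t)` at `0`
  have hq : ∀ i, Tendsto (fun t : ℝ≥0 => (t : ℝ)⁻¹ * (Real.exp (ν i * t) - 1)) (𝓝[>] 0)
      (𝓝 (ν i)) := by
    intro i
    have h1 : HasDerivAt (fun r : ℝ => Real.exp (ν i * r)) (ν i) 0 := by
      have := ((hasDerivAt_id (0 : ℝ)).const_mul (ν i)).exp
      simpa using this
    have h2 := (hasDerivAt_iff_tendsto_slope_zero.1 h1)
    have h3 : Tendsto (fun t : ℝ≥0 => (t : ℝ)) (𝓝[>] 0) (𝓝[≠] 0) := by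
      refine tendsto_nhdsWithin_iff.2 ⟨?_, ?_⟩
      · exact (NNReal.continuous_coe.tendsto 0).mono_left nhdsWithin_le_nhds
      · filter_upwards [self_mem_nhdsWithin] with t ht
        have : 0 < t := ht
        simpa using this.ne'
    refine (h2.comp h3).congr fun t => ?_
    simp
  have hcoord : ∀ (t : ℝ≥0) i, inner ℝ (e i) ((t : ℝ)⁻¹ • (S.op t x - x)) =
      (t : ℝ)⁻¹ * (Real.exp (ν i * t) - 1) * inner ℝ (e i) x := by
    intro t i
    rw [inner_smul_right, inner_sub_right, hS]
    ring
  constructor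
  · intro h i
    have h1 : Tendsto (fun t : ℝ≥0 => inner ℝ (e i) ((t : ℝ)⁻¹ • (S.op t x - x))) (𝓝[>] 0)
      (𝓝 (inner ℝ (e i) y)) := tendsto_const_nhds.inner h
    simp only [hcoord] at h1
    exact tendsto_nhds_unique h1 ((hq i).mul_const _)
  · intro h
    refine tendsto_sub_nhds_zero_iff.1 ?_
    refine tendsto_zero_of_inner e (g := y) (C := Real.exp |ω| + 1) ?_ fun i => ?_
    · have : Iic (1 : ℝ≥0) ∈ 𝓝[>] (0 : ℝ≥0) :=
        mem_nhdsWithin_of_mem_nhds (Iic_mem_nhds zero_lt_one)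
      filter_upwards [this, self_mem_nhdsWithin] with t ht ht0 i
      have ht1 : (t : ℝ) ≤ 1 := by exact_mod_cast ht
      have ht0' : (0 : ℝ) < t := by exact_mod_cast ht0
      have hle : ν i * t ≤ |ω| :=
        (mul_le_mul_of_nonneg_right ((hν i).trans (le_abs_self ω)) t.2).trans
          (mul_le_of_le_one_right (abs_nonneg ω) ht1)
      have hb := abs_exp_sub_one_le_mul hle (abs_nonneg ω)
      have hq' : |(t : ℝ)⁻¹ * (Real.exp (ν i * t) - 1)| ≤ Real.exp |ω| * |ν i| := by
        rw [abs_mul, abs_of_pos (inv_pos.2 ht0'), inv_mul_le_iff₀ ht0']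
        refine hb.trans (le_of_eq ?_)
        rw [abs_mul, abs_of_pos ht0']
        ring
      rw [inner_sub_right, hcoord, h i, ← sub_mul, abs_mul, abs_mul, ← mul_assoc]
      gcongr
      refine (abs_sub _ _).trans ?_
      linarith
    · simp only [inner_sub_right, hcoord, h i, ← sub_mul]
      simpa using ((hq i).sub_const (ν i)).mul_const (inner ℝ (e i) x)

/-- A semigroup whose generator is diagonal is itself diagonal; in particular the semigroup is
determined by its generator. -/
theorem isDiagSemigroup_of_generatorRel {e : HilbertBasis ι ℝ H} {ν : ι → ℝ}
    {S : C0Semigroup H} (hS : ∀ x y, S.GeneratorRel x y ↔ IsDiagPair e ν x y) :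
    IsDiagSemigroup e ν S := by
  intro t x i
  have key : (innerSL ℝ (e i)).comp (S.op t) = Real.exp (ν i * t) • innerSL ℝ (e i) := by
    refine ContinuousLinearMap.ext_on (s := range e) ?_ ?_
    · rw [dense_iff_closure_eq, ← Submodule.topologicalClosure_coe, e.dense_span]
      rfl
    · rintro _ ⟨j, rfl⟩
      exact S.apply_op_of_eigenfunctional (innerSL ℝ (e i))
        (fun x y h => (hS x y).1 h i) ((hS _ _).2 (isDiagPair_basis e ν j)) t
  exact DFunLike.congr_fun key x

theorem IsDiagSemigroup.norm_op_le {e : HilbertBasis ι ℝ H} {ν : ι → ℝ} {S : C0Semigroup H}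
    (hS : IsDiagSemigroup e ν S) {ω : ℝ} {x : H} (h : ∀ i, inner ℝ (e i) x = 0 ∨ ν i ≤ ω)
    (t : ℝ≥0) : ‖S.op t x‖ ≤ Real.exp (ω * t) * ‖x‖ := by
  refine norm_le_of_abs_inner_le e (Real.exp_pos _).le fun i => ?_
  rw [hS, abs_mul, Real.abs_exp]
  rcases h i with h | h
  · simp [h]
  · gcongr

end Diagonal

/-! ### Stabilizability of diagonal systems -/

section DiagonalSystem

variable {ι : Type*}

theorem finite_setOf_le_of_tendsto_atBot {ν : ι → ℝ} (hν : Tendsto ν cofinite atBot) (r : ℝ) :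
    {i | r ≤ ν i}.Finite := by
  have h := hν.eventually (eventually_lt_atBot r)
  simpa [Filter.eventually_cofinite] using h

theorem exists_neg_bound_of_tendsto_atBot {ν : ι → ℝ} (hν : Tendsto ν cofinite atBot)
    {Z : Set ι} (hZ : ∀ i ∈ Z, ν i < 0) : ∃ ω < 0, ∀ i ∈ Z, ν i ≤ ω := by
  have hfin : (Z ∩ {i | -1 ≤ ν i}).Finite :=
    (finite_setOf_le_of_tendsto_atBot hν (-1)).inter_of_right Z
  rcases (Z ∩ {i | -1 ≤ ν i}).eq_empty_or_nonempty with h | h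
  · refine ⟨-1, by norm_num, fun i hi => ?_⟩
    by_contra! hlt
    exact (h.le ⟨hi, hlt.le⟩ : i ∈ (∅ : Set ι))
  · obtain ⟨j, hj, hmax⟩ := Set.exists_max_image _ ν hfin h
    refine ⟨ν j, hZ j hj.1, fun i hi => ?_⟩
    rcases le_or_gt (-1) (ν i) with hi' | hi'
    · exact hmax i ⟨hi, hi'⟩
    · exact hi'.le.trans hj.2

/-- Uniqueness for general Dirichlet series: the coefficient of the largest exponent is the limit
of the series after division by that exponential. -/
theorem eq_zero_of_tsum_mul_exp_eq_zero {ν c : ι → ℝ} (hinj : Function.Injective ν)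
    (hν : Tendsto ν cofinite atBot) (hc : Summable fun i => |c i|)
    (h : ∀ t : ℝ≥0, ∑' i, c i * Real.exp (ν i * t) = 0) (i : ι) : c i = 0 := by
  by_contra hi
  obtain ⟨j, hj, hmax⟩ := Set.exists_max_image ({l | c l ≠ 0} ∩ {l | ν i ≤ ν l}) ν
    ((finite_setOf_le_of_tendsto_atBot hν (ν i)).inter_of_right _) ⟨i, hi, le_refl (ν i)⟩
  have hle : ∀ l, c l ≠ 0 → ν l ≤ ν j := fun l hl => by
    rcases le_total (ν i) (ν l) with h' | h'
    · exact hmax l ⟨hl, h'⟩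
    · exact h'.trans hj.2
  classical
  have hlim : Tendsto (fun t : ℝ≥0 => ∑' l, c l * Real.exp ((ν l - ν j) * t)) atTop
      (𝓝 (∑' l, if l = j then c j else 0)) := by
    refine tendsto_tsum_of_dominated_convergence hc (fun l => ?_) (.of_forall fun t l => ?_)
    · split_ifs with hl
      · simp [hl]
      · by_cases hcl : c l = 0
        · simp [hcl]
        have hlt : 0 < ν j - ν l :=
          sub_pos.2 (lt_of_le_of_ne (hle l hcl) fun e => hl (hinj e))
        have h1 : Tendsto (fun t : ℝ≥0 => (ν j - ν l) * (t : ℝ)) atTop atTop :=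
          (NNReal.tendsto_coe_atTop.2 tendsto_id).const_mul_atTop hlt
        have h2 := (Real.tendsto_exp_neg_atTop_nhds_zero.comp h1).const_mul (c l)
        rw [mul_zero] at h2
        refine h2.congr fun t => ?_
        simp only [Function.comp_apply]
        congr 2
        ring
    · rw [Real.norm_eq_abs, abs_mul, Real.abs_exp]
      by_cases hcl : c l = 0
      · simp [hcl]
      refine mul_le_of_le_one_right (abs_nonneg _) (Real.exp_le_one_iff.2 ?_)
      exact mul_nonpos_of_nonpos_of_nonneg (by linarith [hle l hcl]) t.2
  have hzero : ∀ t : ℝ≥0, ∑' l, c l * Real.exp ((ν l - ν j) * t) = 0 := fun t => by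
    have e : ∀ l, c l * Real.exp ((ν l - ν j) * t) =
        c l * Real.exp (ν l * t) * Real.exp (-ν j * t) := fun l => by
      rw [mul_assoc, ← Real.exp_add]
      congr 2
      ring
    simp_rw [e]
    rw [tsum_mul_right, h, zero_mul]
  simp only [hzero, tsum_ite_eq] at hlim
  exact hj.1 (tendsto_nhds_unique tendsto_const_nhds hlim).symm

variable {H : Type*} [NormedAddCommGroup H] [InnerProductSpace ℝ H]

theorem mem_uncontrollableSubspace_iff [CompleteSpace H] (S : C0Semigroup H) (b x : H) :
    x ∈ uncontrollableSubspace S (ContinuousLinearMap.toSpanSingleton ℝ b) ↔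
      ∀ t, inner ℝ (S.op t b) x = 0 := by
  simp only [uncontrollableSubspace, Submodule.mem_iInf, LinearMap.mem_ker]
  refine forall_congr' fun t => ?_
  change ContinuousLinearMap.adjoint (ContinuousLinearMap.toSpanSingleton ℝ b)
    (ContinuousLinearMap.adjoint (S.op t) x) = 0 ↔ _
  have h1 : inner ℝ (1 : ℝ) (ContinuousLinearMap.adjoint (ContinuousLinearMap.toSpanSingleton ℝ b)
      (ContinuousLinearMap.adjoint (S.op t) x)) = inner ℝ (S.op t b) x := by
    rw [ContinuousLinearMap.adjoint_inner_right, ContinuousLinearMap.adjoint_inner_right]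
    simp
  rw [← h1]
  simp

/-- The uncontrollable subspace of a diagonal system is the closed span of the eigenvectors `e i`
orthogonal to `b`, here described by coordinates. -/
theorem IsDiagSemigroup.mem_uncontrollableSubspace_iff [CompleteSpace H] {e : HilbertBasis ι ℝ H}
    {ν : ι → ℝ} (hinj : Function.Injective ν) (hν : Tendsto ν cofinite atBot)
    {S : C0Semigroup H} (hS : IsDiagSemigroup e ν S) (b x : H) :
    x ∈ uncontrollableSubspace S (ContinuousLinearMap.toSpanSingleton ℝ b) ↔
      ∀ i, inner ℝ (e i) b = 0 ∨ inner ℝ (e i) x = 0 := by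
  rw [DiffusionStab.mem_uncontrollableSubspace_iff]
  have hsum : ∀ t, inner ℝ (S.op t b) x =
      ∑' i, (inner ℝ (e i) b * inner ℝ (e i) x) * Real.exp (ν i * t) := fun t => by
    rw [← e.tsum_inner_mul_inner]
    refine tsum_congr fun i => ?_
    rw [real_inner_comm, hS]
    ring
  constructor
  · intro h i
    refine mul_eq_zero.1 (eq_zero_of_tsum_mul_exp_eq_zero hinj hν
      (c := fun i => inner ℝ (e i) b * inner ℝ (e i) x) ?_ (fun t => (hsum t).symm.trans (h t)) i)
    have h1 := (e.summable_inner_mul_inner b x).abs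
    simpa only [real_inner_comm b] using h1
  · intro h t
    rw [hsum]
    refine (tsum_congr fun i => ?_).trans tsum_zero
    rw [mul_eq_zero.2 (h i), zero_mul]

/-- The shear `x ↦ x - ⟪a, x⟫ v` along a vector `v` orthogonal to `a`. -/
def shear (a v : H) (h : inner ℝ a v = 0) : H ≃L[ℝ] H :=
  ContinuousLinearEquiv.equivOfInverse
    (ContinuousLinearMap.id ℝ H - (innerSL ℝ a).smulRight v)
    (ContinuousLinearMap.id ℝ H + (innerSL ℝ a).smulRight v)
    (fun x => by simp [inner_sub_right, inner_smul_right, h])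
    (fun x => by simp [inner_add_right, inner_smul_right, h])

theorem shear_apply (a v : H) (h : inner ℝ a v = 0) (x : H) :
    shear a v h x = x - inner ℝ a x • v := rfl

/-- Every diagonal system whose unstable modes are all controllable is exponentially stabilizable.

The modes in `s` are shifted one at a time. A feedback through the coordinate of one mode `j` moves
its eigenvalue to any prescribed `μ` and leaves the other eigenvalues alone; a shear along the
vector `v` brings the closed-loop operator back to diagonal form with respect to the same basis, and
it multiplies the coordinate `i ≠ j` of the input vector by `(ν j - ν i) / (μ - ν i) ≠ 0`, so that
the other modes stay controllable. -/
theorem exists_feedback_of_diagonal (e : HilbertBasis ι ℝ H) (s : Finset ι) :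
    ∀ (ν : ι → ℝ) (b : H), Function.Injective ν → Tendsto ν cofinite atBot →
      (∀ i, 0 ≤ ν i → i ∈ s) → (∀ i ∈ s, inner ℝ (e i) b ≠ 0) →
      ∃ (F : H →L[ℝ] ℝ) (T : C0Semigroup H), T.IsExponentiallyStable ∧
        ∀ x y, T.GeneratorRel x y ↔ IsDiagPair e ν x (y - F x • b) := by
  classical
  induction s using Finset.induction_on with
  | empty =>
    intro ν b _ hν hs _
    obtain ⟨ω, hω, hle⟩ := exists_neg_bound_of_tendsto_atBot hν (Z := univ) fun i _ => by
      by_contra! h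
      exact absurd (hs i h) (Finset.notMem_empty i)
    have hle' : ∀ i, ν i ≤ ω := fun i => hle i trivial
    obtain ⟨S, hS⟩ := exists_isDiagSemigroup e hle'
    refine ⟨0, S, ⟨1, one_pos, -ω, neg_pos.2 hω, fun t x => ?_⟩, fun x y => ?_⟩
    · simpa using hS.norm_op_le (x := x) (fun i => Or.inr (hle' i)) t
    · simpa using hS.generatorRel_iff hle' x y
  | insert j s hj ih =>
    intro ν b hinj hν hs hb
    have hbj : inner ℝ (e j) b ≠ 0 := hb j (Finset.mem_insert_self j s)
    obtain ⟨μ, hμ, hμν⟩ : ∃ μ ∈ Ioo (-1 : ℝ) 0, μ ∉ ν '' {i | -1 ≤ ν i} :=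
      (Ioo_infinite (by norm_num)).exists_notMem_finite
        ((finite_setOf_le_of_tendsto_atBot hν (-1)).image ν)
    have hne : ∀ i, μ - ν i ≠ 0 := fun i h => by
      have h' : ν i = μ := by linarith
      exact hμν ⟨i, by rw [mem_ofPred_eq, h']; exact hμ.1.le, h'⟩
    set f : ℝ := (μ - ν j) / inner ℝ (e j) b with hf
    have hfb : f * inner ℝ (e j) b = μ - ν j := div_mul_cancel₀ _ hbj
    obtain ⟨C, hC⟩ : ∃ C, ∀ i, |f / (μ - ν i)| ≤ C := by
      have h1 : Tendsto (fun i => μ - ν i) cofinite atTop :=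
        tendsto_atTop_add_const_left _ μ (tendsto_neg_atBot_atTop.comp hν)
      obtain ⟨C, hC⟩ := (h1.const_div_atTop f).abs.bddAbove_range_of_cofinite
      exact ⟨C, fun i => hC ⟨i, rfl⟩⟩
    obtain ⟨v, hv⟩ := exists_inner_eq_mul e
      (m := fun i => if i = j then 0 else f / (μ - ν i)) (C := C) (fun i => by
        split_ifs
        · simpa using (abs_nonneg _).trans (hC i)
        · exact hC i) b
    have hvj : inner ℝ (e j) v = 0 := by simp [hv]
    have hvi : ∀ i, i ≠ j → (μ - ν i) * inner ℝ (e i) v = f * inner ℝ (e i) b := fun i hi => by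
      rw [hv, if_neg hi, ← mul_assoc, mul_div_cancel₀ _ (hne i)]
    set P := shear (e j) v hvj with hP
    have hPc : ∀ x i, inner ℝ (e i) (P x) =
        inner ℝ (e i) x - inner ℝ (e j) x * inner ℝ (e i) v := fun x i => by
      rw [hP, shear_apply, inner_sub_right, inner_smul_right]
    have hinj' : Function.Injective (Function.update ν j μ) := by
      intro i l hil
      rcases eq_or_ne i j with h' | hi <;> rcases eq_or_ne l j with h | hl
      · exact h'.trans h.symm
      · rw [h', Function.update_self, Function.update_of_ne hl] at hil
        exact absurd (sub_eq_zero.2 hil) (hne l)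
      · rw [h, Function.update_self, Function.update_of_ne hi] at hil
        exact absurd (sub_eq_zero.2 hil.symm) (hne i)
      · rw [Function.update_of_ne hi, Function.update_of_ne hl] at hil
        exact hinj hil
    have hν' : Tendsto (Function.update ν j μ) cofinite atBot := by
      refine hν.congr' ?_
      filter_upwards [(Set.finite_singleton j).compl_mem_cofinite] with i hi
      exact (Function.update_of_ne hi _ _).symm
    have hs' : ∀ i, 0 ≤ Function.update ν j μ i → i ∈ s := by
      intro i hi
      rcases eq_or_ne i j with rfl | hij
      · rw [Function.update_self] at hi
        exact absurd hi (not_le.2 hμ.2)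
      · rw [Function.update_of_ne hij] at hi
        exact Finset.mem_of_mem_insert_of_ne (hs i hi) hij
    have hb' : ∀ i ∈ s, inner ℝ (e i) (P b) ≠ 0 := by
      intro i hi h0
      have hij : i ≠ j := fun h => hj (h ▸ hi)
      rw [hPc] at h0
      have h1 : (ν j - ν i) * inner ℝ (e i) b = 0 := by
        linear_combination (μ - ν i) * h0 + inner ℝ (e j) b * hvi i hij +
          inner ℝ (e i) b * hfb
      rcases mul_eq_zero.1 h1 with h2 | h2
      · exact hij (hinj (sub_eq_zero.1 h2)).symm
      · exact hb i (Finset.mem_insert_of_mem hi) h2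
    obtain ⟨F, T, hT, hTgen⟩ := ih (Function.update ν j μ) (P b) hinj' hν' hs' hb'
    refine ⟨f • innerSL ℝ (e j) + F.comp (P : H →L[ℝ] H), T.conj P.symm, hT.conj _,
      fun x y => ?_⟩
    rw [T.generatorRel_conj, hTgen, ContinuousLinearEquiv.symm_symm]
    set w : H := y - F (P x) • b with hw
    have e1 : P y - F (P x) • P b = P w := by simp [hw]
    have e2 : y - (f • innerSL ℝ (e j) + F.comp (P : H →L[ℝ] H)) x • b =
        w - (f * inner ℝ (e j) x) • b := by
      simp only [hw, add_apply, smul_apply, innerSL_apply_apply, smul_eq_mul,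
        ContinuousLinearMap.comp_apply, ContinuousLinearEquiv.coe_coe, add_smul]
      abel
    rw [e1, e2]
    simp only [IsDiagPair, hPc, inner_sub_right, inner_smul_right]
    have hjj : (inner ℝ (e j) w - f * inner ℝ (e j) x * inner ℝ (e j) b =
        ν j * inner ℝ (e j) x) ↔ inner ℝ (e j) w = μ * inner ℝ (e j) x := by
      rw [mul_right_comm, hfb]
      constructor <;> intro h <;> linear_combination h
    constructor
    · intro h i
      have hj' := h j
      simp only [hvj, mul_zero, sub_zero, Function.update_self] at hj'
      rcases eq_or_ne i j with rfl | hi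
      · exact hjj.2 hj'
      · have hi' := h i
        rw [Function.update_of_ne hi, hj'] at hi'
        linear_combination hi' + inner ℝ (e j) x * hvi i hi
    · intro h i
      have hj' := hjj.1 (h j)
      rcases eq_or_ne i j with rfl | hi
      · simpa [hvj] using hj'
      · rw [Function.update_of_ne hi, hj']
        linear_combination h i - inner ℝ (e j) x * hvi i hi

/-- For a diagonal system, both notions of stabilizability and both notions of stability of the
uncontrollable part mean that every eigenvalue whose eigenvector is orthogonal to `b` is
negative. -/
theorem stabilizable_iff_of_diagonal [CompleteSpace H] (e : HilbertBasis ι ℝ H) {ν : ι → ℝ}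
    (hinj : Function.Injective ν) (hν : Tendsto ν cofinite atBot) {A : H →ₗ.[ℝ] H}
    (hA : ∀ x y, (x, y) ∈ A.graph ↔ IsDiagPair e ν x y) (b : H) :
    (∃ S : C0Semigroup H, IsGenerator A S) ∧
    ∀ S : C0Semigroup H, IsGenerator A S →
      (IsStabilizable A (ContinuousLinearMap.toSpanSingleton ℝ b) ↔
        IsAsymptoticallyStable (restrictTo A
          (uncontrollableSubspace S (ContinuousLinearMap.toSpanSingleton ℝ b)))) ∧
      (IsExponentiallyStabilizable A (ContinuousLinearMap.toSpanSingleton ℝ b) ↔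
        IsExponentiallyStable (restrictTo A
          (uncontrollableSubspace S (ContinuousLinearMap.toSpanSingleton ℝ b)))) := by
  obtain ⟨ω, hω⟩ : ∃ ω, ∀ i, ν i ≤ ω := by
    obtain ⟨ω, hω⟩ := (hν.isBoundedUnder_le_atBot).bddAbove_range_of_cofinite
    exact ⟨ω, fun i => hω ⟨i, rfl⟩⟩
  refine ⟨?_, fun S hS => ?_⟩
  · obtain ⟨S, hS⟩ := exists_isDiagSemigroup e hω
    exact ⟨S, fun x y => (hA x y).trans (hS.generatorRel_iff hω x y).symm⟩
  have hdiag : IsDiagSemigroup e ν S :=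
    isDiagSemigroup_of_generatorRel fun x y => (hS x y).symm.trans (hA x y)
  set B := ContinuousLinearMap.toSpanSingleton ℝ b with hB
  set N := uncontrollableSubspace S B with hN
  have hmem : ∀ x, x ∈ N ↔ ∀ i, inner ℝ (e i) b = 0 ∨ inner ℝ (e i) x = 0 :=
    hdiag.mem_uncontrollableSubspace_iff hinj hν b
  -- the spectral condition to which the four properties are equivalent
  set Q : Prop := ∀ i, inner ℝ (e i) b = 0 → ν i < 0 with hQ
  have stab_Q : IsStabilizable A B → Q := by
    rintro ⟨F, T, hT, hTs⟩ i hi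
    have hrel : ∀ x y, T.GeneratorRel x y ↔ IsDiagPair e ν x (y - B (F x)) := fun x y => by
      rw [← hA, ← mem_graph_closedLoop]
      exact (hT x y).symm
    refine hTs.eigenvalue_neg (innerSL ℝ (e i)) (x := e i) (y := ν i • e i + B (F (e i)))
      (fun x y h => ?_) ?_ ?_
    · have := (hrel x y).1 h i
      simpa [hB, inner_sub_right, inner_smul_right, hi] using this
    · rw [hrel, add_sub_cancel_right]
      exact isDiagPair_basis e ν i
    · simp [e.orthonormal.1 i]
  have Q_exp : Q → IsExponentiallyStabilizable A B := by
    intro hq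
    obtain ⟨F, T, hT, hTgen⟩ := exists_feedback_of_diagonal e
      (finite_setOf_le_of_tendsto_atBot hν 0).toFinset ν b hinj hν (by simp) (fun i hi h0 => by
        simp only [Finite.mem_toFinset, mem_ofPred_eq] at hi
        exact absurd (hq i h0) (not_lt.2 hi))
    refine ⟨F, T, fun x y => ?_, hT⟩
    rw [mem_graph_closedLoop, hA]
    exact (hTgen x y).symm
  have res_Q : IsAsymptoticallyStable (restrictTo A N) → Q := by
    rintro ⟨T, hT, hTs⟩ i hi
    have hrel : ∀ x y : N, T.GeneratorRel x y ↔ IsDiagPair e ν (x : H) y := fun x y => by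
      rw [← hA, ← mem_graph_restrictTo]
      exact (hT x y).symm
    classical
    have hei : e i ∈ N := by
      rw [hmem]
      intro l
      rcases eq_or_ne l i with rfl | hl
      · exact Or.inl hi
      · exact Or.inr (by rw [inner_basis_eq_ite, if_neg hl])
    refine hTs.eigenvalue_neg ((innerSL ℝ (e i)).comp N.subtypeL) (x := ⟨e i, hei⟩)
      (y := ν i • ⟨e i, hei⟩) (fun x y h => (hrel x y).1 h i) ?_ ?_
    · rw [hrel]
      exact isDiagPair_basis e ν i
    · simp [e.orthonormal.1 i]
  have Q_res : Q → IsExponentiallyStable (restrictTo A N) := by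
    intro hq
    have hinv : ∀ t, ∀ x ∈ N, S.op t x ∈ N := fun t x hx => by
      rw [hmem] at hx ⊢
      intro i
      refine (hx i).imp_right fun h => ?_
      rw [hdiag, h, mul_zero]
    obtain ⟨ω', hω', hle⟩ := exists_neg_bound_of_tendsto_atBot hν
      (Z := {i | inner ℝ (e i) b = 0}) hq
    refine ⟨S.restrict N hinv, hS.restrictTo N hinv, 1, one_pos, -ω', neg_pos.2 hω',
      fun t x => ?_⟩
    have h1 := hdiag.norm_op_le (x := x) (ω := ω')
      (fun i => ((hmem x).1 x.2 i).symm.imp_right (hle i)) t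
    rw [one_mul, neg_mul, neg_neg]
    exact h1
  have exp_stab : IsExponentiallyStabilizable A B → IsStabilizable A B :=
    fun ⟨F, hF⟩ => ⟨F, hF.isAsymptoticallyStable⟩
  exact ⟨⟨fun h => (Q_res (stab_Q h)).isAsymptoticallyStable, fun h => exp_stab (Q_exp (res_Q h))⟩,
    ⟨fun h => Q_res (stab_Q (exp_stab h)), fun h => Q_exp (res_Q h.isAsymptoticallyStable)⟩⟩

end DiagonalSystem

/-! ### Completeness of the sine system -/

theorem integral_cos_int_mul_pi (k : ℤ) :
    ∫ x in (0 : ℝ)..1, Real.cos (k * Real.pi * x) = if k = 0 then 1 else 0 := by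
  split_ifs with h
  · simp [h]
  · have hk : (k : ℝ) * Real.pi ≠ 0 := mul_ne_zero (by exact_mod_cast h) Real.pi_ne_zero
    rw [intervalIntegral.integral_comp_mul_left (fun x => Real.cos x) hk, integral_cos]
    simp [Real.sin_int_mul_pi]

theorem integral_two_mul_sin_mul_sin (n m : ℕ) :
    ∫ x in (0 : ℝ)..1, 2 * (Real.sin ((n + 1) * Real.pi * x) * Real.sin ((m + 1) * Real.pi * x)) =
      if n = m then 1 else 0 := by
  have e : ∀ x : ℝ, 2 * (Real.sin ((n + 1) * Real.pi * x) * Real.sin ((m + 1) * Real.pi * x)) =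
      Real.cos (((n - m : ℤ) : ℝ) * Real.pi * x) -
        Real.cos (((n + m + 2 : ℤ) : ℝ) * Real.pi * x) := by
    intro x
    have h1 : (((n - m : ℤ) : ℝ) * Real.pi * x) =
      (n + 1) * Real.pi * x - (m + 1) * Real.pi * x := by push_cast; ring
    have h2 : (((n + m + 2 : ℤ) : ℝ) * Real.pi * x) =
      (n + 1) * Real.pi * x + (m + 1) * Real.pi * x := by push_cast; ring
    rw [h1, h2, Real.cos_sub, Real.cos_add]
    ring
  simp_rw [e]
  rw [intervalIntegral.integral_sub (Continuous.intervalIntegrable (by fun_prop) _ _)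
    (Continuous.intervalIntegrable (by fun_prop) _ _), integral_cos_int_mul_pi,
    integral_cos_int_mul_pi, if_neg (show ¬ ((n : ℤ) + m + 2 = 0) by omega), sub_zero]
  simp only [sub_eq_zero, Nat.cast_inj]

/-- A square integrable function on `(0, 1)` with vanishing sine coefficients is zero: all Fourier
coefficients of its odd extension to `(-1, 1)` vanish. -/
theorem ae_eq_zero_of_integral_sin_eq_zero {h : ℝ → ℝ}
    (hL2 : MemLp h 2 (volume.restrict (Ioo (0 : ℝ) 1)))
    (h0 : ∀ n : ℕ, ∫ x in Ioo (0 : ℝ) 1, Real.sin ((n + 1) * Real.pi * x) * h x = 0) :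
    h =ᵐ[volume.restrict (Ioo (0 : ℝ) 1)] 0 := by
  set u : ℝ → ℝ := (Ioo (0 : ℝ) 1).indicator h with hu
  have hu2 : MemLp u 2 volume := (memLp_indicator_iff_restrict measurableSet_Ioo).2 hL2
  have hun : MemLp (fun x => u (-x)) 2 volume :=
    hu2.comp_measurePreserving (Measure.measurePreserving_neg volume)
  have hint : ∀ n : ℤ, ∫ x in (-1 : ℝ)..1, Real.sin (n * Real.pi * x) * u x = 0 := by
    intro n
    have hpos : ∀ m : ℕ, ∫ x in (-1 : ℝ)..1, Real.sin ((m + 1) * Real.pi * x) * u x = 0 := by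
      intro m
      rw [intervalIntegral.integral_of_le (by norm_num), ← h0 m]
      have e : (fun x => Real.sin ((m + 1) * Real.pi * x) * u x) =
          (Ioo (0 : ℝ) 1).indicator fun x => Real.sin ((m + 1) * Real.pi * x) * h x := by
        funext x
        by_cases hx : x ∈ Ioo (0 : ℝ) 1 <;> simp [hu, hx]
      rw [e, setIntegral_indicator measurableSet_Ioo]
      congr 2
      rw [inter_eq_right]
      exact fun x hx => ⟨by linarith [hx.1], hx.2.le⟩
    obtain ⟨m, rfl | rfl⟩ := n.eq_nat_or_neg
    · cases m with
      | zero => simp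
      | succ m => simpa using hpos m
    · cases m with
      | zero => simp
      | succ m =>
        have := hpos m
        simp only [Nat.cast_add, Nat.cast_one, Int.cast_neg, Int.cast_add, Int.cast_natCast,
          Int.cast_one, neg_mul, Real.sin_neg, intervalIntegral.integral_neg, neg_eq_zero]
        exact this
  set f : ℝ → ℂ := fun x => ((u x - u (-x) : ℝ) : ℂ) with hf
  have hf2 : MemLp f 2 (volume.restrict (Ioc (-1 : ℝ) 1)) := ((hu2.sub hun).restrict _).ofReal
  have hcoef : ∀ n : ℤ, fourierCoeffOn (show (-1 : ℝ) < 1 by norm_num) f n = 0 := by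
    intro n
    rw [fourierCoeffOn_eq_integral]
    refine smul_eq_zero_of_right _ ?_
    have hφ : ∀ x : ℝ, (fourier (-n) (x : AddCircle ((1 : ℝ) - -1)) : ℂ) =
        Complex.exp (-(n * Real.pi * x : ℝ) * Complex.I) := by
      intro x
      rw [fourier_coe_apply]
      congr 1
      push_cast
      ring
    have i1 : ∀ v : ℝ → ℝ, MemLp v 2 volume → IntervalIntegrable
        (fun x : ℝ => Complex.exp (-(n * Real.pi * x : ℝ) * Complex.I) * (v x : ℂ))
        volume (-1) 1 := by
      intro v hv
      have hv1 : IntervalIntegrable (fun x => (v x : ℂ)) volume (-1) 1 := by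
        rw [intervalIntegrable_iff_integrableOn_Ioc_of_le (by norm_num)]
        exact ((hv.restrict (Ioc (-1 : ℝ) 1)).ofReal (K := ℂ)).integrable (by norm_num)
      exact hv1.continuousOn_mul (Continuous.continuousOn (by fun_prop))
    have e1 : ∀ x : ℝ, (fourier (-n) (x : AddCircle ((1 : ℝ) - -1)) : ℂ) • f x =
        Complex.exp (-(n * Real.pi * x : ℝ) * Complex.I) * (u x : ℂ) -
        Complex.exp (-(n * Real.pi * x : ℝ) * Complex.I) * (u (-x) : ℂ) := by
      intro x
      rw [hφ, hf]
      push_cast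
      rw [smul_eq_mul, mul_sub]
    simp_rw [e1]
    rw [intervalIntegral.integral_sub (i1 u hu2) (i1 _ hun)]
    have e2 : ∫ x in (-1 : ℝ)..1,
          Complex.exp (-(n * Real.pi * x : ℝ) * Complex.I) * (u (-x) : ℂ) =
        ∫ x in (-1 : ℝ)..1, Complex.exp ((n * Real.pi * x : ℝ) * Complex.I) * (u x : ℂ) := by
      have := intervalIntegral.integral_comp_neg (a := -1) (b := 1)
        (fun x : ℝ => Complex.exp ((n * Real.pi * x : ℝ) * Complex.I) * (u x : ℂ))
      rw [neg_neg] at this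
      rw [← this]
      refine intervalIntegral.integral_congr fun x _ => ?_
      simp
    have i2 : IntervalIntegrable
        (fun x : ℝ => Complex.exp ((n * Real.pi * x : ℝ) * Complex.I) * (u x : ℂ))
        volume (-1) 1 := by
      have hv1 : IntervalIntegrable (fun x => (u x : ℂ)) volume (-1) 1 := by
        rw [intervalIntegrable_iff_integrableOn_Ioc_of_le (by norm_num)]
        exact ((hu2.restrict (Ioc (-1 : ℝ) 1)).ofReal (K := ℂ)).integrable (by norm_num)
      exact hv1.continuousOn_mul (Continuous.continuousOn (by fun_prop))
    rw [e2, ← intervalIntegral.integral_sub (i1 u hu2) i2]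
    have e3 : ∀ x : ℝ, Complex.exp (-(n * Real.pi * x : ℝ) * Complex.I) * (u x : ℂ) -
        Complex.exp ((n * Real.pi * x : ℝ) * Complex.I) * (u x : ℂ) =
        (-2 * Complex.I) * ((Real.sin (n * Real.pi * x) * u x : ℝ) : ℂ) := by
      intro x
      rw [← sub_mul, Complex.exp_mul_I, Complex.exp_mul_I, Complex.cos_neg, Complex.sin_neg]
      push_cast
      ring
    simp_rw [e3]
    rw [intervalIntegral.integral_const_mul, intervalIntegral.integral_ofReal, hint]
    simp
  have hpars := tsum_sq_fourierCoeffOn (show (-1 : ℝ) < 1 by norm_num) hf2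
  simp only [hcoef, norm_zero, ne_eq, OfNat.ofNat_ne_zero, not_false_eq_true, zero_pow,
    tsum_zero] at hpars
  have hz : ∫ x in (-1 : ℝ)..1, ‖f x‖ ^ 2 = 0 := by
    rcases smul_eq_zero.1 hpars.symm with h' | h'
    · norm_num at h'
    · exact h'
  rw [intervalIntegral.integral_of_le (by norm_num), integral_eq_zero_iff_of_nonneg
    (fun x => by positivity) hf2.integrable_norm_pow'] at hz
  have hsub : Ioo (0 : ℝ) 1 ⊆ Ioc (-1) 1 := fun x hx => ⟨by linarith [hx.1], hx.2.le⟩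
  filter_upwards [ae_restrict_of_ae_restrict_of_subset hsub hz,
    ae_restrict_mem measurableSet_Ioo] with x hx hx'
  have hneg : -x ∉ Ioo (0 : ℝ) 1 := fun h' => by linarith [h'.1, hx'.1]
  simpa [hf, hu, hx', hneg] using hx

/-! ### The eigenbasis of the diffusion operator -/

theorem integral_weightMeasure (α : ℝ) (f : ℝ → ℝ) :
    ∫ ξ, f ξ ∂weightMeasure α = ∫ ξ in Ioo (0 : ℝ) 1, Real.exp (-α * ξ) * f ξ := by
  rw [weightMeasure, integral_withDensity_eq_integral_toReal_smul (by fun_prop) (by simp)]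
  refine integral_congr_ae (.of_forall fun ξ => ?_)
  simp [Real.exp_nonneg]

theorem integrable_weightMeasure_iff (α : ℝ) (f : ℝ → ℝ) :
    Integrable f (weightMeasure α) ↔
      IntegrableOn (fun ξ => Real.exp (-α * ξ) * f ξ) (Ioo (0 : ℝ) 1) := by
  rw [weightMeasure, integrable_withDensity_iff_integrable_smul' (by fun_prop) (by simp)]
  refine integrable_congr (.of_forall fun ξ => ?_)
  simp [Real.exp_nonneg]

theorem memLp_weightMeasure_of_continuousOn (α : ℝ) {f : ℝ → ℝ} (hf : ContinuousOn f (Icc 0 1)) :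
    MemLp f 2 (weightMeasure α) := by
  obtain ⟨C, hC⟩ := isCompact_Icc.exists_bound_of_continuousOn hf
  refine MemLp.of_bound ?_ C ?_
  · exact ((hf.mono Ioo_subset_Icc_self).aestronglyMeasurable measurableSet_Ioo).mono_ac
      (weightMeasure_ac α)
  · filter_upwards [ae_mem_Ioo α] with x hx using hC x (Ioo_subset_Icc_self hx)

/-- The eigenfunction `√2 exp(α ξ / 2) sin((n + 1) π ξ)` of the diffusion operator. The index is
shifted so that all natural numbers are used. -/
def eigenFun (α : ℝ) (n : ℕ) (ξ : ℝ) : ℝ :=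
  √2 * (Real.exp (α / 2 * ξ) * Real.sin ((n + 1) * Real.pi * ξ))

/-- The eigenvalue of `h ↦ h'' - α h'` belonging to `eigenFun α n`. -/
def eigenValue (α : ℝ) (n : ℕ) : ℝ := -(α ^ 2 / 4 + ((n + 1) * Real.pi) ^ 2)

/-- The eigenfunction times the weight `exp(-α ξ)`, without the normalization. -/
def weightedSine (α : ℝ) (n : ℕ) (ξ : ℝ) : ℝ :=
  Real.exp (-(α / 2) * ξ) * Real.sin ((n + 1) * Real.pi * ξ)

theorem memLp_eigenFun (α : ℝ) (n : ℕ) : MemLp (eigenFun α n) 2 (weightMeasure α) :=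
  memLp_weightMeasure_of_continuousOn α (Continuous.continuousOn (by unfold eigenFun; fun_prop))

theorem inner_eigenFun (α : ℝ) (n : ℕ) {g : StateSpace α} {f : ℝ → ℝ}
    (h : g =ᵐ[weightMeasure α] f) :
    inner ℝ ((memLp_eigenFun α n).toLp (eigenFun α n)) g =
      √2 * ∫ ξ in Ioo (0 : ℝ) 1, weightedSine α n ξ * f ξ := by
  rw [L2.inner_def, ← integral_const_mul]
  have e : (fun ξ => inner ℝ ((memLp_eigenFun α n).toLp (eigenFun α n) ξ) (g ξ))
      =ᵐ[weightMeasure α] fun ξ => eigenFun α n ξ * f ξ := by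
    filter_upwards [h, (memLp_eigenFun α n).coeFn_toLp] with ξ h1 h2
    rw [h1, h2]
    simp [mul_comm]
  rw [integral_congr_ae e, integral_weightMeasure]
  refine integral_congr_ae (.of_forall fun ξ => ?_)
  have : Real.exp (-α * ξ) * Real.exp (α / 2 * ξ) = Real.exp (-(α / 2) * ξ) := by
    rw [← Real.exp_add]
    congr 1
    ring
  simp only [eigenFun, weightedSine, ← this]
  ring

theorem orthonormal_eigenFun (α : ℝ) :
    Orthonormal ℝ fun n => (memLp_eigenFun α n).toLp (eigenFun α n) := by
  rw [orthonormal_iff_ite]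
  intro n m
  rw [inner_eigenFun α n (memLp_eigenFun α m).coeFn_toLp, ← integral_two_mul_sin_mul_sin n m,
    intervalIntegral.integral_of_le zero_le_one, integral_Ioc_eq_integral_Ioo,
    ← integral_const_mul]
  refine integral_congr_ae (.of_forall fun ξ => ?_)
  have h1 : Real.exp (-(α / 2) * ξ) * Real.exp (α / 2 * ξ) = 1 := by
    rw [← Real.exp_add]
    simp
  have h2 : √2 * √2 = (2 : ℝ) := Real.mul_self_sqrt (by norm_num)
  simp only [eigenFun, weightedSine]
  calc _ = (√2 * √2) * (Real.exp (-(α / 2) * ξ) * Real.exp (α / 2 * ξ)) *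
        (Real.sin ((n + 1) * Real.pi * ξ) * Real.sin ((m + 1) * Real.pi * ξ)) := by ring
    _ = _ := by rw [h1, h2, mul_one]

theorem eq_zero_of_inner_eigenFun (α : ℝ) {g : StateSpace α}
    (hg : ∀ n, inner ℝ ((memLp_eigenFun α n).toLp (eigenFun α n)) g = 0) : g = 0 := by
  set h : ℝ → ℝ := fun ξ => Real.exp (-(α / 2) * ξ) * g ξ with hh
  have hmeas : AEStronglyMeasurable (g : ℝ → ℝ) (volume.restrict (Ioo (0 : ℝ) 1)) :=
    (Lp.memLp g).aestronglyMeasurable.mono_ac (ac_weightMeasure α)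
  have hL2 : MemLp h 2 (volume.restrict (Ioo (0 : ℝ) 1)) := by
    have hexp : Continuous fun ξ : ℝ => Real.exp (-(α / 2) * ξ) := by fun_prop
    have hmeas' : AEStronglyMeasurable h (volume.restrict (Ioo (0 : ℝ) 1)) :=
      hexp.aestronglyMeasurable.mul hmeas
    rw [memLp_two_iff_integrable_sq hmeas']
    have h1 := (integrable_weightMeasure_iff α _).1 (Lp.memLp g).integrable_sq
    refine h1.congr (.of_forall fun ξ => ?_)
    simp only [hh, mul_pow]
    rw [← Real.exp_nat_mul]
    congr 2
    push_cast
    ring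
  have hz := ae_eq_zero_of_integral_sin_eq_zero hL2 fun n => by
    have h1 := hg n
    rw [inner_eigenFun α n (ae_eq_refl _)] at h1
    refine Eq.trans ?_ ((mul_eq_zero.1 h1).resolve_left (by positivity))
    refine integral_congr_ae (.of_forall fun ξ => ?_)
    simp only [hh, weightedSine]
    ring
  refine (Lp.eq_zero_iff_ae_eq_zero).2 ?_
  filter_upwards [(weightMeasure_ac α).ae_le hz] with ξ hξ
  exact (mul_eq_zero.1 hξ).resolve_left (Real.exp_pos _).ne'

/-- The Hilbert basis of eigenfunctions of the diffusion operator. -/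
def eigenBasis (α : ℝ) : HilbertBasis ℕ ℝ (StateSpace α) :=
  HilbertBasis.mkOfOrthogonalEqBot (orthonormal_eigenFun α) <| by
    rw [Submodule.eq_bot_iff]
    intro g hg
    refine eq_zero_of_inner_eigenFun α fun n => ?_
    exact Submodule.inner_right_of_mem_orthogonal (Submodule.subset_span (mem_range_self n)) hg

theorem inner_eigenBasis (α : ℝ) (n : ℕ) {g : StateSpace α} {f : ℝ → ℝ}
    (h : g =ᵐ[weightMeasure α] f) :
    inner ℝ (eigenBasis α n) g = √2 * ∫ ξ in Ioo (0 : ℝ) 1, weightedSine α n ξ * f ξ := by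
  rw [eigenBasis, HilbertBasis.coe_mkOfOrthogonalEqBot, inner_eigenFun α n h]

/-! ### The diffusion operator is diagonal -/

theorem mem_graph_diffusionA₀ {α : ℝ} (x g : StateSpace α) :
    (x, g) ∈ (diffusionA₀ α).graph ↔ ∃ f, InDomain α f ∧ x =ᵐ[weightMeasure α] f ∧
      g =ᵐ[weightMeasure α] diffusionExpr α f := by
  rw [LinearPMap.mem_graph_iff]
  constructor
  · rintro ⟨z, h1, h2⟩
    obtain ⟨f, hf, e⟩ := z.2
    dsimp only at h1 h2
    exact ⟨f, hf, h1 ▸ e, h2 ▸ diffusionA₀_apply z hf e⟩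
  · rintro ⟨f, hf, e, e'⟩
    have hx : x ∈ (diffusionA₀ α).domain := ⟨f, hf, e⟩
    have h := diffusionA₀_apply ⟨x, hx⟩ hf e
    exact ⟨⟨x, hx⟩, rfl, Lp.ext (h.trans e'.symm)⟩

theorem mem_graph_diffusionA {α k : ℝ} (x y : StateSpace α) :
    (x, y) ∈ (diffusionA α k).graph ↔ (x, y - k • x) ∈ (diffusionA₀ α).graph := by
  simp only [LinearPMap.mem_graph_iff]
  constructor
  · rintro ⟨z, h1, h2⟩
    refine ⟨z, h1, ?_⟩
    rw [← h2, ← h1]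
    exact (add_sub_cancel_left (k • (z : StateSpace α)) _).symm
  · rintro ⟨z, h1, h2⟩
    refine ⟨z, h1, ?_⟩
    subst h1
    exact (congrArg (k • (z : StateSpace α) + ·) h2).trans (add_sub_cancel _ _)

theorem deriv_eq_d1 (f : ℝ → ℝ) {x : ℝ} (hx : x ∈ Ioo (0 : ℝ) 1) : deriv f x = d1 f x :=
  (derivWithin_of_mem_nhds (Icc_mem_nhds hx.1 hx.2)).symm

/-- Two integrations by parts; the boundary terms vanish since both the sine and the functions of
the domain vanish at the end points. -/
theorem InDomain.integral_weightedSine_mul_diffusionExpr {α : ℝ} {f : ℝ → ℝ} (hf : InDomain α f)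
    (n : ℕ) : ∫ ξ in Ioo (0 : ℝ) 1, weightedSine α n ξ * diffusionExpr α f ξ =
      eigenValue α n * ∫ ξ in Ioo (0 : ℝ) 1, weightedSine α n ξ * f ξ := by
  set ω : ℝ := (n + 1) * Real.pi with hω
  set s : ℝ → ℝ := weightedSine α n with hs
  set s' : ℝ → ℝ := fun ξ => Real.exp (-(α / 2) * ξ) *
    (-(α / 2) * Real.sin (ω * ξ) + ω * Real.cos (ω * ξ)) with hs'
  -- the function `s' + α s`
  set r : ℝ → ℝ := fun ξ => Real.exp (-(α / 2) * ξ) *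
    (α / 2 * Real.sin (ω * ξ) + ω * Real.cos (ω * ξ)) with hr
  have hexp : ∀ ξ : ℝ, HasDerivAt (fun ξ => Real.exp (-(α / 2) * ξ))
      (Real.exp (-(α / 2) * ξ) * -(α / 2)) ξ := fun ξ => by
    simpa using ((hasDerivAt_id ξ).const_mul (-(α / 2))).exp
  have hsin : ∀ ξ : ℝ, HasDerivAt (fun ξ => Real.sin (ω * ξ)) (Real.cos (ω * ξ) * ω) ξ :=
    fun ξ => by simpa using ((hasDerivAt_id ξ).const_mul ω).sin
  have hcos : ∀ ξ : ℝ, HasDerivAt (fun ξ => Real.cos (ω * ξ)) (-Real.sin (ω * ξ) * ω) ξ :=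
    fun ξ => by simpa using ((hasDerivAt_id ξ).const_mul ω).cos
  have ds : deriv s = s' := funext fun ξ => by
    refine (((hexp ξ).mul (hsin ξ)).congr_deriv ?_).deriv
    simp only [hs']
    ring
  have dr : deriv r = fun ξ => eigenValue α n * s ξ := funext fun ξ => by
    refine (((hexp ξ).mul (((hsin ξ).const_mul (α / 2)).add
      ((hcos ξ).const_mul ω))).congr_deriv ?_).deriv
    simp only [hs, weightedSine, eigenValue, ← hω, Pi.add_apply]
    ring
  have sAC : AbsolutelyContinuousOnInterval s 0 1 := by
    have : ContDiff ℝ 1 s := by unfold s weightedSine; fun_prop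
    exact this.contDiffOn.absolutelyContinuousOnInterval
  have rAC : AbsolutelyContinuousOnInterval r 0 1 := by
    have : ContDiff ℝ 1 r := by unfold r; fun_prop
    exact this.contDiffOn.absolutelyContinuousOnInterval
  have s0 : s 0 = 0 := by simp [hs, weightedSine]
  have s1 : s 1 = 0 := by
    have : Real.sin ((n + 1) * Real.pi) = 0 := by
      simpa using Real.sin_nat_mul_pi (n + 1)
    simp [hs, weightedSine, this]
  have p1 := sAC.integral_mul_deriv_eq_deriv_mul hf.ac_d1
  have p2 := rAC.integral_mul_deriv_eq_deriv_mul hf.ac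
  rw [s0, s1, ds] at p1
  rw [hf.left, hf.right, dr] at p2
  simp only [zero_mul, sub_zero, zero_sub, mul_zero] at p1 p2
  simp only [intervalIntegral.integral_of_le zero_le_one, integral_Ioc_eq_integral_Ioo] at p1 p2
  have cd1 : ContinuousOn (d1 f) (Icc 0 1) := by
    simpa [uIcc_of_le] using hf.ac_d1.continuousOn
  have i1 : IntegrableOn (fun ξ => s ξ * deriv (d1 f) ξ) (Ioo 0 1) := by
    have := hf.ac_d1.intervalIntegrable_deriv.continuousOn_mul sAC.continuousOn
    rwa [intervalIntegrable_iff_integrableOn_Ioo_of_le zero_le_one] at this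
  have i2 : ∀ v : ℝ → ℝ, Continuous v → IntegrableOn (fun ξ => v ξ * d1 f ξ) (Ioo 0 1) :=
    fun v hv => ((hv.continuousOn.mul cd1).integrableOn_Icc).mono_set Ioo_subset_Icc_self
  have cs : Continuous s := by unfold s weightedSine; fun_prop
  have cs' : Continuous s' := by unfold s'; fun_prop
  have p2' : ∫ ξ in Ioo (0 : ℝ) 1, r ξ * deriv f ξ = ∫ ξ in Ioo (0 : ℝ) 1, r ξ * d1 f ξ :=
    setIntegral_congr_fun measurableSet_Ioo fun ξ hξ => by
      simp only [deriv_eq_d1 f hξ]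
  have hrs : ∀ ξ, r ξ * d1 f ξ = s' ξ * d1 f ξ + α * (s ξ * d1 f ξ) := fun ξ => by
    simp only [hr, hs', hs, weightedSine, ← hω]
    ring
  rw [p2'] at p2
  simp_rw [hrs] at p2
  rw [integral_add (i2 s' cs') ((i2 s cs).const_mul α), integral_const_mul] at p2
  have hexpr : ∀ ξ, s ξ * diffusionExpr α f ξ = s ξ * deriv (d1 f) ξ - α * (s ξ * d1 f ξ) :=
    fun ξ => by
      simp only [diffusionExpr, d2, Pi.sub_apply, Pi.smul_apply, smul_eq_mul]
      ring
  simp_rw [hexpr]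
  rw [integral_sub i1 ((i2 s cs).const_mul α), integral_const_mul, p1]
  simp_rw [mul_assoc] at p2
  rw [integral_const_mul] at p2
  linarith

/-- The boundary value problem `f'' - α f' = g`, `f(0) = f(1) = 0` is solvable for every square
integrable `g`. With the weight as integrating factor the equation reads
`(exp(-α ξ) f')' = exp(-α ξ) g`, and it is integrated twice. -/
theorem exists_inDomain_diffusionExpr_eq {α : ℝ} {g : ℝ → ℝ} (hg : MemLp g 2 (weightMeasure α)) :
    ∃ f, InDomain α f ∧ diffusionExpr α f =ᵐ[weightMeasure α] g := by
  set G : ℝ → ℝ := (Ioo (0 : ℝ) 1).indicator fun ξ => Real.exp (-α * ξ) * g ξ with hG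
  have hGint : Integrable G volume :=
    ((integrable_weightMeasure_iff α g).1 (hg.integrable (by norm_num))).integrable_indicator
      measurableSet_Ioo
  set I : ℝ → ℝ := fun x => ∫ t in (0 : ℝ)..x, G t with hI
  have cI : Continuous I := intervalIntegral.continuous_primitive
    (fun a b => hGint.intervalIntegrable) 0
  have cE : Continuous fun x : ℝ => Real.exp (α * x) := by fun_prop
  have hE : 0 < ∫ x in (0 : ℝ)..1, Real.exp (α * x) :=
    intervalIntegral.intervalIntegral_pos_of_pos (cE.intervalIntegrable _ _)
      (fun x => Real.exp_pos _) zero_lt_one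
  -- the constant of integration that makes the second integral vanish at `1`
  set c : ℝ := -(∫ x in (0 : ℝ)..1, Real.exp (α * x) * I x) / ∫ x in (0 : ℝ)..1, Real.exp (α * x)
    with hc
  set d : ℝ → ℝ := fun x => Real.exp (α * x) * (c + I x) with hd
  have cd : Continuous d := by unfold d; fun_prop
  set f : ℝ → ℝ := fun x => ∫ t in (0 : ℝ)..x, d t with hf
  have df : ∀ x, HasDerivAt f (d x) x := fun x => (cd.integral_hasStrictDerivAt 0 x).hasDerivAt
  have d1f : EqOn (d1 f) d (Icc 0 1) := fun x hx =>
    (df x).hasDerivWithinAt.derivWithin (uniqueDiffOn_Icc zero_lt_one x hx)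
  have dAC : AbsolutelyContinuousOnInterval d 0 1 := by
    have h1 : AbsolutelyContinuousOnInterval (fun x : ℝ => Real.exp (α * x)) 0 1 := by
      have : ContDiff ℝ 1 fun x : ℝ => Real.exp (α * x) := by fun_prop
      exact this.contDiffOn.absolutelyContinuousOnInterval
    have h2 : AbsolutelyContinuousOnInterval (fun _ : ℝ => c) 0 1 :=
      (contDiff_const (c := c)).contDiffOn.absolutelyContinuousOnInterval
    have h3 : AbsolutelyContinuousOnInterval I 0 1 :=
      (hGint.intervalIntegrable (a := 0) (b := 1)).absolutelyContinuousOnInterval_intervalIntegral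
        (by simp)
    exact h1.mul (h2.add h3)
  have d2f : d2 f =ᵐ[weightMeasure α] α • d + g := by
    have h1 := (weightMeasure_ac α).ae_le (ae_restrict_of_ae
      (hGint.intervalIntegrable (a := 0) (b := 1)).ae_hasDerivAt_integral)
    filter_upwards [h1, ae_mem_Ioo α] with x hx hx'
    have hI' : HasDerivAt I (G x) x :=
      hx (by rw [uIcc_of_le zero_le_one]; exact Ioo_subset_Icc_self hx') 0 (by simp)
    have hexp : HasDerivAt (fun x => Real.exp (α * x)) (Real.exp (α * x) * α) x := by
      simpa using ((hasDerivAt_id x).const_mul α).exp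
    have hdd := hexp.mul (hI'.const_add c)
    rw [d2, deriv_eqOn_Ioo d1f hx']
    refine hdd.deriv.trans ?_
    have h3 : Real.exp (α * x) * Real.exp (-α * x) = 1 := by rw [← Real.exp_add]; simp
    simp only [Pi.add_apply, Pi.smul_apply, smul_eq_mul, hd, hG, indicator_of_mem hx']
    linear_combination g x * h3
  refine ⟨f, ⟨?_, fun x _ => (df x).differentiableAt.differentiableWithinAt, ?_, ?_, ?_, ?_⟩, ?_⟩
  · have : ContDiff ℝ 1 f := by
      rw [contDiff_one_iff_deriv]
      refine ⟨fun x => (df x).differentiableAt, ?_⟩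
      rwa [show deriv f = d from funext fun x => (df x).deriv]
    exact this.contDiffOn.absolutelyContinuousOnInterval
  · exact ac_congr dAC d1f.symm
  · exact (((memLp_weightMeasure_of_continuousOn α cd.continuousOn).const_smul α).add hg).ae_eq
      d2f.symm
  · simp [hf]
  · simp only [hf, hd, mul_add]
    rw [intervalIntegral.integral_add (Continuous.intervalIntegrable (by fun_prop) _ _)
      (Continuous.intervalIntegrable (by fun_prop) _ _), intervalIntegral.integral_mul_const, hc,
      mul_div_cancel₀ _ hE.ne', neg_add_cancel]
  · filter_upwards [d2f, ae_mem_Ioo α] with x hx hx'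
    simp only [diffusionExpr, Pi.sub_apply, Pi.smul_apply, hx, d1f (Ioo_subset_Icc_self hx'),
      Pi.add_apply, add_sub_cancel_left]

theorem eigenValue_ne_zero (α : ℝ) (n : ℕ) : eigenValue α n ≠ 0 := by
  have : 0 < ((n + 1) * Real.pi) ^ 2 := by positivity
  exact neg_ne_zero.2 (by positivity)

/-- The operator `A` is the maximal diagonal operator with respect to its eigenfunctions. The graph of
the diagonal operator is contained in the graph of `A` because a solution of the boundary value
problem with right-hand side `y - k x` has the same coordinates as `x`. -/
theorem mem_graph_diffusionA_iff_isDiagPair {α k : ℝ} (x y : StateSpace α) :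
    (x, y) ∈ (diffusionA α k).graph ↔
      IsDiagPair (eigenBasis α) (fun n => eigenValue α n + k) x y := by
  rw [mem_graph_diffusionA, mem_graph_diffusionA₀]
  have hcoord : ∀ n, inner ℝ (eigenBasis α n) (y - k • x) =
      inner ℝ (eigenBasis α n) y - k * inner ℝ (eigenBasis α n) x := fun n => by
    rw [inner_sub_right, inner_smul_right]
  constructor
  · rintro ⟨f, hf, e, e'⟩ n
    have h1 := inner_eigenBasis α n e'
    rw [hf.integral_weightedSine_mul_diffusionExpr, mul_left_comm, ← inner_eigenBasis α n e,
      hcoord] at h1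
    linear_combination h1
  · intro h
    obtain ⟨f, hf, hfg⟩ := exists_inDomain_diffusionExpr_eq (Lp.memLp (y - k • x))
    have hfL : MemLp f 2 (weightMeasure α) :=
      memLp_weightMeasure_of_continuousOn α hf.diff.continuousOn
    have hx : x = hfL.toLp f := by
      refine ext_inner_basis (eigenBasis α) fun n => ?_
      have h1 := inner_eigenBasis α n hfg.symm
      rw [hf.integral_weightedSine_mul_diffusionExpr, mul_left_comm,
        ← inner_eigenBasis α n hfL.coeFn_toLp, hcoord, h n] at h1
      exact mul_left_cancel₀ (eigenValue_ne_zero α n) (by linear_combination h1)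
    exact ⟨f, hf, by rw [hx]; exact hfL.coeFn_toLp, hfg.symm⟩

theorem injective_eigenValue (α k : ℝ) : Function.Injective fun n => eigenValue α n + k := by
  intro n m h
  have h1 : ((n + 1) * Real.pi) ^ 2 = ((m + 1) * Real.pi) ^ 2 := by
    simp only [eigenValue] at h
    linarith
  have h2 := (sq_eq_sq₀ (by positivity) (by positivity)).1 h1
  have h3 := mul_right_cancel₀ Real.pi_ne_zero h2
  exact_mod_cast add_right_cancel h3

theorem tendsto_eigenValue (α k : ℝ) :
    Tendsto (fun n => eigenValue α n + k) cofinite atBot := by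
  rw [Nat.cofinite_eq_atTop]
  refine tendsto_atBot_add_const_right _ k (tendsto_neg_atTop_atBot.comp ?_)
  refine tendsto_atTop_add_const_left _ _ ?_
  refine (tendsto_pow_atTop two_ne_zero).comp ?_
  exact (tendsto_atTop_add_const_right _ 1 tendsto_natCast_atTop_atTop).atTop_mul_const
    Real.pi_pos

end DiffusionStab

end

open DiffusionStab in
/-- `A₂₂` is the restriction of `A` to the uncontrollable subspace `N = ⋂_{t≥0} ker B* S*(t)`,
where `S` is the semigroup generated by `A`. -/
theorem proposition3p1 (α k : ℝ) (hα : 0 < α) (hk : 0 < k) (b : StateSpace α) :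
    (∃ S : C0Semigroup (StateSpace α), IsGenerator (diffusionA α k) S) ∧
    ∀ S : C0Semigroup (StateSpace α), IsGenerator (diffusionA α k) S →
      (IsStabilizable (diffusionA α k) (inputOp b) ↔
        IsAsymptoticallyStable
          (restrictTo (diffusionA α k) (uncontrollableSubspace S (inputOp b)))) ∧
      (IsExponentiallyStabilizable (diffusionA α k) (inputOp b) ↔
        IsExponentiallyStable
          (restrictTo (diffusionA α k) (uncontrollableSubspace S (inputOp b)))) := by
  exact stabilizable_iff_of_diagonal (eigenBasis α) (injective_eigenValue α k)
    (tendsto_eigenValue α k) mem_graph_diffusionA_iff_isDiagPair b
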